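/- All rings are commutative with $1$. **Valuations.** Let $R$ be a noetherian local ring with maximal ideal $\mathfrak m$ (zero divisors and nilpotents are allowed). A valuation on $R$ is a map $\nu:R\to\Gamma\cup\{\infty\}$, with $\Gamma$ a (totally) ordered abelian group, such that $\nu(ab)=\nu(a)+\nu(b)$, $\nu(a+b)\ge\min\{\nu(a),\nu(b)\}$, $\nu(1)=0$, $\nu(0)=\infty$, and such that $\operatorname{supp}(\nu)=\{a\in R\mid\nu(a)=\infty\}$ is a minimal prime ideal of $R$. It is centered on $R$ if $\nu(a)\ge 0$ for all $a\in R$ and $\nu(a)>0$ for all $a\in\mathfrak m$. Its value group is the subgroup of $\Gamma$ generated by the finite values $\nu(a)$, $a\in R$, and its rank is the number of proper convex subgroups of the value group. **Local blowing ups.** Let $\nu$ be centered on $R$, let $b\in R\setminus\operatorname{supp}(\nu)$ and let $a_1,\dots,a_r\in R$ with $\nu(a_i)\ge\nu(b)$ for all $i$. Extend $\nu$ to $R_b$ by $\nu(a/b^n)=\nu(a)-n\nu(b)$, let $J(b)=\ker(R\to R_b)$, let $R'=(R/J(b))[a_1/b,\dots,a_r/b]\subseteq R_b$, and let $R^{(1)}$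 be the localization of $R'$ at the prime ideal $\{x\in R'\mid\nu(x)>0\}$. The canonical map $R\to R^{(1)}$ is called a local blowing up of $R$ with respect to $\nu$. **Local uniformization.** A valuation $\nu$ centered on $R$ admits local uniformization if there is a local blowing up $R\to R^{(1)}$ with respect to $\nu$ such that, with $I_{(1)}$ the nilradical of $R^{(1)}$, the local ring $(R^{(1)})_{\mathrm{red}}=R^{(1)}/I_{(1)}$ is regular and $I_{(1)}^n/I_{(1)}^{n+1}$ is a free $(R^{(1)})_{\mathrm{red}}$-module for every $n\in\mathbb N$. **Theorem.** Let $\mathcal M$ be a subcategory of the category of noetherian local rings with the following two closure properties: every nonzero homomorphic image of an object of $\mathcal M$ is an object of $\mathcal M$; and if $R$ is an object of $\mathcal M$, $R'$ is a finitely generated $R$-subalgebra of the total ring of fractions of $R$ (a finitely generated birational extension) and $\mathfrak P$ is a prime ideal of $R'$, then $R'_{\mathfrak P}$ is an object of $\mathcal M$. Assume that for every object $R$ of $\mathcal M$, every valuation of rank one centered on $R$ admits local uniformization. Then, for every object $R$ of $\mathcal M$, every valuation (of arbitrary rank) centered on $R$ admits local uniformization. -/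

import Mathlib

universe u v

namespace LocalUniformization

open IsLocalRing CategoryTheory

section Valuations

variable {A : Type u} [CommRing A] {Γ : Type v} [AddCommGroup Γ] [LinearOrder Γ]
  [IsOrderedAddMonoid Γ]

/-- The value group of `ν : A → Γ ∪ {∞}`: the subgroup of `Γ` generated by the finite values. -/
def valueGroup (ν : AddValuation A (WithTop Γ)) : AddSubgroup Γ :=
  AddSubgroup.closure {γ : Γ | ∃ a : A, ν a = (γ : WithTop Γ)}

/-- The rank of `ν`: the number of proper convex subgroups of its value group. -/
noncomputable def rank (ν : AddValuation A (WithTop Γ)) : ℕ∞ :=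
  Set.encard {H : AddSubgroup (valueGroup ν) |
    H ≠ ⊤ ∧ (H : Set (valueGroup ν)).OrdConnected}

/-- The center `{a ∈ A | ν a > 0}` of a valuation that is nonnegative on `A`. -/
def center (ν : AddValuation A (WithTop Γ)) (h : ∀ a, 0 ≤ ν a) : Ideal A where
  carrier := {a | 0 < ν a}
  add_mem' := fun ha hb => ν.map_lt_add ha hb
  zero_mem' := by
    change 0 < ν 0
    rw [ν.map_zero]
    exact WithTop.coe_lt_top 0
  smul_mem' := fun c x hx => by
    change 0 < ν (c * x)
    rw [ν.map_mul]
    exact lt_of_lt_of_le hx (le_add_of_nonneg_left (h c))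

instance center_isPrime (ν : AddValuation A (WithTop Γ)) (h : ∀ a, 0 ≤ ν a) :
    (center ν h).IsPrime where
  ne_top' := fun ht => by
    have h1 : 0 < ν 1 := (Ideal.eq_top_iff_one _).1 ht
    rw [ν.map_one] at h1
    exact lt_irrefl _ h1
  mem_or_mem' := fun {x y} hxy => by
    have hxy' : 0 < ν (x * y) := hxy
    rw [ν.map_mul] at hxy'
    by_contra! hcon
    have hx : ν x = 0 := le_antisymm (not_lt.1 hcon.1) (h x)
    have hy : ν y = 0 := le_antisymm (not_lt.1 hcon.2) (h y)
    simp [hx, hy] at hxy'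

/-- `ν` is a valuation centered at the local ring `A`: its support is a minimal prime of `A`
(this is part of the notion of a valuation here), `ν` is nonnegative on `A`, and it is positive
on the maximal ideal of `A`. -/
structure IsCenteredValuation [IsLocalRing A] (ν : AddValuation A (WithTop Γ)) : Prop where
  supp_minimal : ν.supp ∈ minimalPrimes A
  nonneg : ∀ a, 0 ≤ ν a
  pos_of_mem : ∀ a ∈ maximalIdeal A, 0 < ν a

theorem powers_le_primeCompl (ν : AddValuation A (WithTop Γ)) {b : A} (hb : b ∉ ν.supp) :
    Submonoid.powers b ≤ (AddValuation.toValuation ν).supp.primeCompl :=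
  Submonoid.powers_le.2 hb

/-- The extension `ν (a / bⁿ) = ν a - n ν b` of `ν` to the localization `A_b`, for `b` outside
the support of `ν`. -/
noncomputable def extendAway (ν : AddValuation A (WithTop Γ)) {b : A} (hb : b ∉ ν.supp) :
    AddValuation (Localization.Away b) (WithTop Γ) :=
  AddValuation.ofValuation
    ((AddValuation.toValuation ν).extendToLocalization (powers_le_primeCompl ν hb)
      (Localization.Away b))

theorem extendAway_algebraMap (ν : AddValuation A (WithTop Γ)) {b : A} (hb : b ∉ ν.supp)
    (a : A) : extendAway ν hb (algebraMap A (Localization.Away b) a) = ν a :=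
  Valuation.extendToLocalization_apply_map_apply _ (powers_le_primeCompl ν hb) _ a

/-- The fraction `a / b` in `A_b`. -/
noncomputable def frac (a b : A) : Localization.Away b :=
  IsLocalization.mk' (Localization.Away b) a (⟨b, Submonoid.mem_powers b⟩ : Submonoid.powers b)

theorem extendAway_frac_nonneg (ν : AddValuation A (WithTop Γ)) {a b : A} (hb : b ∉ ν.supp)
    (hab : ν b ≤ ν a) : 0 ≤ extendAway ν hb (frac a b) := by
  have hmul : frac a b * algebraMap A (Localization.Away b) b = algebraMap A _ a :=
    IsLocalization.mk'_spec _ _ _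
  have hval := congrArg (extendAway ν hb) hmul
  rw [AddValuation.map_mul, extendAway_algebraMap, extendAway_algebraMap] at hval
  rw [← hval] at hab
  have hb' : ν b ≠ ⊤ := fun h => hb ((AddValuation.mem_supp_iff ν b).2 h)
  exact WithTop.le_of_add_le_add_right hb' (by simpa using hab)

/-- The centers of local blowing ups of `A` with respect to `ν`: elements `b, a₁, …, a_r` with
`b` outside the support of `ν` and `ν aᵢ ≥ ν b` for all `i`. -/
structure BlowupData (ν : AddValuation A (WithTop Γ)) where
  b : A
  b_notMem : b ∉ ν.supp
  r : ℕ
  a : Fin r → A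
  le : ∀ i, ν b ≤ ν (a i)

namespace BlowupData

variable {ν : AddValuation A (WithTop Γ)} (D : BlowupData ν)

/-- The subring `A' = A/J(b)[a₁/b, …, a_r/b]` of `A_b`, where `J(b)` is the kernel of
`A → A_b`. -/
noncomputable def affineRing : Subalgebra A (Localization.Away D.b) :=
  Algebra.adjoin A (Set.range fun i => frac (D.a i) D.b)

/-- The restriction to `A'` of the extension of `ν` to `A_b`. -/
noncomputable def affineValuation : AddValuation D.affineRing (WithTop Γ) :=
  (extendAway ν D.b_notMem).comap D.affineRing.val.toRingHom

theorem affineValuation_nonneg (h : ∀ a, 0 ≤ ν a) (x : D.affineRing) :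
    0 ≤ D.affineValuation x := by
  change 0 ≤ extendAway ν D.b_notMem (x : Localization.Away D.b)
  obtain ⟨x, hx⟩ := x
  change 0 ≤ extendAway ν D.b_notMem x
  refine Algebra.adjoin_induction (fun y hy => ?_) (fun a => ?_) (fun y z _ _ hy hz => ?_)
    (fun y z _ _ hy hz => ?_) hx
  · obtain ⟨i, rfl⟩ := hy
    exact extendAway_frac_nonneg ν D.b_notMem (D.le i)
  · rw [extendAway_algebraMap]
    exact h a
  · exact AddValuation.map_le_add _ hy hz
  · rw [AddValuation.map_mul]
    exact add_nonneg hy hz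

/-- The local ring `A⁽¹⁾ = A'_𝔠` of the local blowing up, the localization of `A'` at the center
`𝔠` of `ν` on `A'`. The local blowing up is the canonical map `A → A⁽¹⁾`. -/
abbrev localRing (h : ∀ a, 0 ≤ ν a) : Type u :=
  Localization.AtPrime (center D.affineValuation (D.affineValuation_nonneg h))

end BlowupData

end Valuations

/-- `Spec A` is normally flat along `Spec A_red`: with `I` the nilradical of `A`, the
`A/I`-modules `Iⁿ/Iⁿ⁺¹` are free. Here `Iⁿ/Iⁿ⁺¹` is written as the quotient of the `A`-module
`Iⁿ` by its submodule `I • Iⁿ = Iⁿ⁺¹`. -/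
def IsNormallyFlatAlongRed (A : Type u) [CommRing A] : Prop :=
  ∀ n : ℕ, Module.Free (A ⧸ nilradical A)
    (↥(nilradical A ^ n) ⧸ nilradical A • (⊤ : Submodule A ↥(nilradical A ^ n)))

/-- The valuation `ν` centered at the local ring `A` admits local uniformization. -/
def AdmitsLocalUniformization {A : Type u} [CommRing A] [IsLocalRing A] {Γ : Type v}
    [AddCommGroup Γ] [LinearOrder Γ] [IsOrderedAddMonoid Γ] {ν : AddValuation A (WithTop Γ)}
    (hν : IsCenteredValuation ν) : Prop :=
  ∃ D : BlowupData ν,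
    IsRegularLocalRing (D.localRing hν.nonneg ⧸ nilradical (D.localRing hν.nonneg)) ∧
      IsNormallyFlatAlongRed (D.localRing hν.nonneg)

/-- A class `M` of commutative rings (the objects of a subcategory) is admissible if it consists
of noetherian local rings, and is closed under homomorphic images (that are local rings, that is,
nonzero) and under localizing finitely generated birational extensions at prime ideals. A finitely
generated birational extension of `A` is a finitely generated `A`-subalgebra of the total ring of
fractions of `A`. -/
structure IsAdmissible (M : ObjectProperty CommRingCat.{u}) : Prop where
  isLocalRing : ∀ (A : Type u) [CommRing A], M (.of A) → IsLocalRing A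
  isNoetherianRing : ∀ (A : Type u) [CommRing A], M (.of A) → IsNoetherianRing A
  of_surjective : ∀ (A B : Type u) [CommRing A] [CommRing B] [Nontrivial B] (f : A →+* B),
    Function.Surjective f → M (.of A) → M (.of B)
  of_birational : ∀ (A : Type u) [CommRing A] (A' : Subalgebra A (FractionRing A))
    (P : Ideal A') [P.IsPrime], A'.FG → M (.of A) → M (.of (Localization.AtPrime P))

end LocalUniformization

/-! Let `L` be the localization of `R` at the support of `ν`. Since the support is a minimal prime,
an element of `L` is a unit if its value is finite and nilpotent otherwise. Local blowing ups can
then be carried out inside `L`: adjoin finitely many elements of nonnegative value to the image of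
`R`, then invert the elements of value zero. Such subrings are the models (`IsModel`), and a model
is good (`IsGood`) if its reduction is regular and it is normally flat along it.

The proof (`hasUniformization`) is by induction on the Krull dimension of the model, which does not
grow under these extensions. If all finite values are zero, the reduction is a field; rank one is
the hypothesis. Otherwise a convex subgroup, neither trivial nor everything, gives a proper
coarsening `μ` of `ν`. Once the model contains a non-unit of `μ`-value zero, its localization at the
center of `μ` has smaller dimension, so `μ` can be uniformized; the extension used for this can be
chosen with elements of nonnegative `ν`-value. Let `B` be the new model and `C` its good
localization at the center of `μ`, and let `y` in `B` lift a regular system of parameters of the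
reduction of `C`. The residual part of `ν` lives on the image of `B` in `C ⧸ (y)`, again of smaller
dimension, and is uniformized by induction. One divides by `(y)` and not by the whole center of `μ`
so that the nilpotents survive: normal flatness of the quotient is needed later. No finiteness of
the rank enters.

The two halves are glued by `isGood_of_localization_of_quotient`. Let `P = (y) + I` be prime with
`I` the nilradical, let `B_P` be good of dimension the number of the `y`, and let `B ⧸ (y)` be good.
A count of dimensions makes `B ⧸ I` regular with `y` a regular sequence on it. If `Iᵏ/Iᵏ⁺¹` is free
for all `k < n`, then `y` is regular on `B ⧸ Iⁿ`, so `(y) ∩ Iⁿ = (y)Iⁿ`, and by Nakayama a lift of a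
basis of the `n`-th graded piece of `B ⧸ (y)` generates `Iⁿ`. The number of these generators is at
most the rank of the graded piece at `P`, hence they are independent.

The hypothesis `P = (y) + I` is not automatic. It is arranged in
`hasUniformization_of_isGood_resImage` by one more blowing up, which divides the `y` by an element
of `μ`-value zero. -/

namespace LocalUniformization

open IsLocalRing CategoryTheory

/-! ### Bases of the graded pieces of an ideal, in terms of elements -/

section GradedBasis

variable {A : Type*} [CommRing A]

/-- The classes of `x` form a basis of the `A ⧸ I`-module `Iⁿ/Iⁿ⁺¹`. -/
structure IsGradedBasis (I : Ideal A) (n : ℕ) {ι : Type*} [Fintype ι] (x : ι → A) : Prop where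
  mem : ∀ i, x i ∈ I ^ n
  le_span : I ^ n ≤ Ideal.span (Set.range x) ⊔ I ^ (n + 1)
  indep : ∀ c : ι → A, ∑ i, c i * x i ∈ I ^ (n + 1) → ∀ i, c i ∈ I

/-- The graded piece `Iⁿ/Iⁿ⁺¹`. -/
abbrev gradedPiece (I : Ideal A) (n : ℕ) : Type _ :=
  ↥(I ^ n) ⧸ I • (⊤ : Submodule A ↥(I ^ n))

theorem gradedPiece_mk_eq_zero_iff {I : Ideal A} {n : ℕ} (a : ↥(I ^ n)) :
    (Submodule.Quotient.mk a : gradedPiece I n) = 0 ↔ (a : A) ∈ I ^ (n + 1) := by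
  have h : Submodule.map (I ^ n).subtype (I • (⊤ : Submodule A ↥(I ^ n))) = I ^ (n + 1) := by
    rw [Submodule.map_smul'', Submodule.map_top, Submodule.range_subtype, smul_eq_mul, pow_succ']
  rw [Submodule.Quotient.mk_eq_zero, ← h]
  constructor
  · exact fun ha => ⟨a, ha, rfl⟩
  · rintro ⟨b, hb, hba⟩
    rwa [← Subtype.ext hba]

theorem gradedPiece_sum_smul {I : Ideal A} {n : ℕ} {ι : Type*} [Fintype ι] (x : ι → ↥(I ^ n))
    (c : ι → A) :
    ∑ i, Ideal.Quotient.mk I (c i) • (Submodule.Quotient.mk (x i) : gradedPiece I n) =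
      Submodule.Quotient.mk (∑ i, c i • x i) := by
  rw [← Submodule.mkQ_apply, map_sum]
  rfl

theorem exists_eq_sum_add {J : Ideal A} {ι : Type*} [Fintype ι] {x : ι → A} {f : A}
    (hf : f ∈ Ideal.span (Set.range x) ⊔ J) : ∃ c : ι → A, f - ∑ i, c i * x i ∈ J := by
  obtain ⟨a, ha, b, hb, rfl⟩ := Submodule.mem_sup.1 hf
  obtain ⟨c, rfl⟩ := (Ideal.mem_span_range_iff_exists_fun).1 ha
  exact ⟨c, by simpa using hb⟩

theorem sum_mul_mem_span {ι : Type*} [Fintype ι] (c x : ι → A) :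
    ∑ i, c i * x i ∈ Ideal.span (Set.range x) :=
  Ideal.mem_span_range_iff_exists_fun.2 ⟨c, rfl⟩

/-- With the converse `IsGradedBasis.free`, this turns freeness into conditions on elements of `A`,
which are easier to move between a ring, its localizations and its quotients than modules over
varying rings. -/
theorem exists_isGradedBasis [IsNoetherianRing A] (I : Ideal A) (n : ℕ)
    [Module.Free (A ⧸ I) (gradedPiece I n)] :
    ∃ (r : ℕ) (x : Fin r → A), IsGradedBasis I n x := by
  have : Module.Finite (A ⧸ I) (gradedPiece I n) := Module.Finite.of_restrictScalars_finite A _ _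
  let b := (Module.Free.chooseBasis (A ⧸ I) (gradedPiece I n)).reindex (Fintype.equivFin _)
  choose x hx using fun i => Submodule.Quotient.mk_surjective _ (b i)
  refine ⟨_, fun i => (x i : A), fun i => (x i).2, fun f hf => ?_, fun c hc => ?_⟩
  · have hsum := b.sum_repr (Submodule.Quotient.mk ⟨f, hf⟩)
    choose c hc using fun i => Ideal.Quotient.mk_surjective (b.repr (Submodule.Quotient.mk ⟨f, hf⟩) i)
    simp_rw [← hc, ← hx] at hsum
    rw [gradedPiece_sum_smul, eq_comm, ← sub_eq_zero, ← Submodule.Quotient.mk_sub,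
      gradedPiece_mk_eq_zero_iff] at hsum
    have := Ideal.add_mem (Ideal.span (Set.range fun i => (x i : A)) ⊔ I ^ (n + 1))
      (Ideal.mem_sup_right hsum) (Ideal.mem_sup_left (sum_mul_mem_span c fun i => (x i : A)))
    simpa using this
  · have h0 := (gradedPiece_mk_eq_zero_iff (∑ i, c i • x i)).2 (by simpa using hc)
    rw [← gradedPiece_sum_smul] at h0
    simp_rw [hx] at h0
    intro i
    exact Ideal.Quotient.eq_zero_iff_mem.1 (Fintype.linearIndependent_iff.1 b.linearIndependent _ h0 i)

theorem IsGradedBasis.free {I : Ideal A} {n : ℕ} {ι : Type*} [Fintype ι] {x : ι → A}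
    (h : IsGradedBasis I n x) : Module.Free (A ⧸ I) (gradedPiece I n) := by
  let b : ι → gradedPiece I n := fun i => Submodule.Quotient.mk ⟨x i, h.mem i⟩
  have hb : LinearIndependent (A ⧸ I) b := by
    refine Fintype.linearIndependent_iff.2 fun g hg i => ?_
    choose c hc using fun i => Ideal.Quotient.mk_surjective (g i)
    simp_rw [← hc] at hg ⊢
    rw [gradedPiece_sum_smul, gradedPiece_mk_eq_zero_iff] at hg
    exact Ideal.Quotient.eq_zero_iff_mem.2 (h.indep c (by simpa using hg) i)
  refine Module.Free.of_basis (Module.Basis.mk hb fun m _ => ?_)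
  obtain ⟨⟨f, hf⟩, rfl⟩ := Submodule.Quotient.mk_surjective _ m
  obtain ⟨c, hc⟩ := exists_eq_sum_add (h.le_span hf)
  have : (Submodule.Quotient.mk ⟨f, hf⟩ : gradedPiece I n) =
      ∑ i, Ideal.Quotient.mk I (c i) • b i := by
    rw [gradedPiece_sum_smul, ← sub_eq_zero, ← Submodule.Quotient.mk_sub,
      gradedPiece_mk_eq_zero_iff]
    simpa using hc
  rw [this]
  exact Submodule.sum_mem _ fun i _ => Submodule.smul_mem _ _ (Submodule.subset_span ⟨i, rfl⟩)

theorem IsGradedBasis.map_equiv {A' : Type*} [CommRing A'] (e : A ≃+* A') {I : Ideal A} {n : ℕ}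
    {ι : Type*} [Fintype ι] {x : ι → A} (h : IsGradedBasis I n x) :
    IsGradedBasis (I.map e) n (e ∘ x) := by
  have hmem : ∀ (J : Ideal A) a, e a ∈ J.map e ↔ a ∈ J := fun J a => by
    simp [Ideal.mem_map_of_equiv]
  have key : ∀ k a, e a ∈ I.map e ^ k ↔ a ∈ I ^ k := fun k a => by
    rw [← Ideal.map_pow, hmem]
  refine ⟨fun i => (key _ _).2 (h.mem i), fun f hf => ?_, fun c hc i => ?_⟩
  · obtain ⟨f, rfl⟩ := e.surjective f
    rw [← Ideal.map_pow, Set.range_comp]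
    change _ ∈ Ideal.span ((e : A →+* A') '' _) ⊔ Ideal.map (e : A →+* A') _
    rw [← Ideal.map_span, ← Ideal.map_sup]
    exact (hmem _ _).2 (h.le_span ((key _ _).1 hf))
  · obtain ⟨c, rfl⟩ : ∃ c', c = e ∘ c' := ⟨e.symm ∘ c, by ext; simp⟩
    exact (hmem _ _).2 (h.indep c ((key _ _).1 (by simpa using hc)) i)

end GradedBasis

/-- A local ring whose reduction is regular and that is normally flat along its reduction. -/
def IsGood (A : Type*) [CommRing A] : Prop :=
  IsRegularLocalRing (A ⧸ nilradical A) ∧ IsNormallyFlatAlongRed A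

theorem map_equiv_nilradical {A A' : Type*} [CommRing A] [CommRing A'] (e : A ≃+* A') :
    (nilradical A).map e = nilradical A' := by
  ext x
  rw [Ideal.mem_map_of_equiv, mem_nilradical]
  constructor
  · rintro ⟨a, ha, rfl⟩
    exact (mem_nilradical.1 ha).map e
  · exact fun hx => ⟨e.symm x, mem_nilradical.2 (hx.map e.symm), by simp⟩

theorem IsNormallyFlatAlongRed.exists_isGradedBasis {A : Type*} [CommRing A] [IsNoetherianRing A]
    (h : IsNormallyFlatAlongRed A) (n : ℕ) :
    ∃ (r : ℕ) (x : Fin r → A), IsGradedBasis (nilradical A) n x :=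
  have := h n
  LocalUniformization.exists_isGradedBasis _ _

theorem IsGood.of_ringEquiv {A A' : Type*} [CommRing A] [CommRing A'] [IsNoetherianRing A]
    (e : A ≃+* A') (h : IsGood A) : IsGood A' := by
  refine ⟨?_, fun n => ?_⟩
  · have := h.1
    exact IsRegularLocalRing.of_ringEquiv
      (Ideal.quotientEquiv (nilradical A) (nilradical A') e (map_equiv_nilradical e).symm)
  · obtain ⟨r, x, hx⟩ := h.2.exists_isGradedBasis n
    have := hx.map_equiv e
    rw [map_equiv_nilradical] at this
    exact this.free

/-! ### Generators of the maximal ideal in number equal to the dimension -/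

section Regular

/-- Take the bottom of a chain of primes that realizes the height of the maximal ideal; the whole
chain lives in the quotient. -/
theorem exists_prime_ringKrullDim_le_quotient {A : Type*} [CommRing A] [IsLocalRing A]
    [IsNoetherianRing A] :
    ∃ q : Ideal A, q.IsPrime ∧ ringKrullDim A ≤ ringKrullDim (A ⧸ q) := by
  obtain ⟨l, -, hlen⟩ := (maximalIdeal A).exists_ltSeries_length_eq_height
  refine ⟨l.head.asIdeal, inferInstance, ?_⟩
  rw [← IsLocalRing.maximalIdeal_height_eq_ringKrullDim, ← hlen, ringKrullDim_quotient]
  let l' : LTSeries (PrimeSpectrum.zeroLocus (l.head.asIdeal : Set A)) :=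
    { length := l.length
      toFun := fun i => ⟨l i, LTSeries.head_le l i⟩
      step := fun i => l.step i }
  exact Order.LTSeries.length_le_krullDim l'

theorem span_range_map_quotient_eq {A : Type*} [CommRing A] [IsLocalRing A] {rs : List A} {r : A}
    [IsLocalRing (A ⧸ Ideal.span {r})]
    (h : Ideal.ofList (r :: rs) = maximalIdeal A) :
    Ideal.ofList (rs.map (Ideal.Quotient.mk (Ideal.span {r}))) =
      maximalIdeal (A ⧸ Ideal.span {r}) := by
  have hmap : (maximalIdeal A).map (Ideal.Quotient.mk (Ideal.span {r})) =
      maximalIdeal (A ⧸ Ideal.span {r}) :=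
    IsLocalRing.map_maximalIdeal_of_surjective _ Ideal.Quotient.mk_surjective
  rw [← hmap, ← h, Ideal.ofList_cons, Ideal.map_sup, Ideal.map_ofList, Ideal.map_quotient_self,
    bot_sup_eq]

theorem spanFinrank_ofList_le {A : Type*} [CommRing A] (rs : List A) :
    (Ideal.ofList rs).spanFinrank ≤ rs.length := by
  classical
  have hfin : {a | a ∈ rs}.Finite := rs.finite_toSet
  refine (Submodule.spanFinrank_span_le_ncard_of_finite hfin).trans ?_
  have : {a | a ∈ rs} = (rs.toFinset : Set A) := by ext; simp
  rw [this, Set.ncard_coe_finset]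
  exact rs.toFinset_card_le

theorem ringKrullDim_le_length {A : Type*} [CommRing A] [IsLocalRing A] [IsNoetherianRing A]
    {rs : List A} (h : Ideal.ofList rs = maximalIdeal A) : ringKrullDim A ≤ rs.length := by
  refine (ringKrullDim_le_spanFinrank_maximalIdeal A).trans ?_
  rw [← h]
  exact_mod_cast spanFinrank_ofList_le rs

theorem ringKrullDim_le_quotient_span_singleton_add_one {A : Type*} [CommRing A] [IsLocalRing A]
    [IsNoetherianRing A] {r : A} (hr : r ∈ maximalIdeal A) :
    ringKrullDim A ≤ ringKrullDim (A ⧸ Ideal.span {r}) + 1 := by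
  have := ringKrullDim_le_ringKrullDim_quotient_add_encard ({r} : Set A)
    (by simpa [IsLocalRing.ringJacobson_eq_maximalIdeal] using hr)
  simpa using this

theorem isLocalRing_quotient {A : Type*} [CommRing A] [IsLocalRing A] {J : Ideal A}
    (hJ : J ≤ maximalIdeal A) : IsLocalRing (A ⧸ J) :=
  have : Nontrivial (A ⧸ J) :=
    Ideal.Quotient.nontrivial_iff.2 fun h => (maximalIdeal.isMaximal A).ne_top (top_le_iff.1 (h ▸ hJ))
  IsLocalRing.of_surjective' _ Ideal.Quotient.mk_surjective

theorem ringKrullDim_quotient_eq_length {A : Type*} [CommRing A] [IsLocalRing A]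
    [IsNoetherianRing A] {r : A} {rs : List A} (h : Ideal.ofList (r :: rs) = maximalIdeal A)
    (hdim : ((r :: rs).length : WithBot ℕ∞) ≤ ringKrullDim A) :
    ∃ _ : IsLocalRing (A ⧸ Ideal.span {r}),
      Ideal.ofList (rs.map (Ideal.Quotient.mk (Ideal.span {r}))) =
        maximalIdeal (A ⧸ Ideal.span {r}) ∧
      ((rs.map (Ideal.Quotient.mk (Ideal.span {r}))).length : WithBot ℕ∞) ≤
        ringKrullDim (A ⧸ Ideal.span {r}) := by
  have hr : r ∈ maximalIdeal A := h ▸ Ideal.subset_span (by simp)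
  have hloc : IsLocalRing (A ⧸ Ideal.span {r}) :=
    isLocalRing_quotient ((Ideal.span_singleton_le_iff_mem _).2 hr)
  refine ⟨hloc, span_range_map_quotient_eq h, ?_⟩
  have h1 := hdim.trans (ringKrullDim_le_quotient_span_singleton_add_one hr)
  rw [List.length_cons] at h1
  rw [List.length_map]
  push_cast at h1
  exact ENat.WithBot.add_le_add_one_right_iff.1 h1

/-- Induction on the number of generators. Let `q` be a prime with `A ⧸ q` of full dimension and `r`
a generator outside `q`. The quotient by `r` is a domain by induction, and dimensions force `q ≤
(r)`; then `q = rq`, so `q = 0` by Nakayama. -/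
theorem isDomain_of_ofList_eq_maximalIdeal (n : ℕ) : ∀ (A : Type u) [CommRing A] [IsLocalRing A]
    [IsNoetherianRing A] (rs : List A), rs.length = n → Ideal.ofList rs = maximalIdeal A →
    (rs.length : WithBot ℕ∞) ≤ ringKrullDim A → IsDomain A := by
  induction n with
  | zero =>
    intro A _ _ _ rs hn h _
    obtain rfl := List.eq_nil_of_length_eq_zero hn
    rw [Ideal.ofList_nil] at h
    exact (IsLocalRing.isField_iff_maximalIdeal_eq.2 h.symm).isDomain
  | succ n ih =>
    intro A _ _ _ rs hn h hdim
    obtain ⟨q, hq, hqdim⟩ := exists_prime_ringKrullDim_le_quotient (A := A)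
    have hqm : q ≤ maximalIdeal A := le_maximalIdeal hq.ne_top
    obtain ⟨r, hr, hrq⟩ : ∃ r ∈ rs, r ∉ q := by
      by_contra! hcon
      have hle : maximalIdeal A ≤ q := h ▸ Ideal.span_le.2 hcon
      have : q.IsMaximal := (le_antisymm hqm hle) ▸ maximalIdeal.isMaximal A
      let := Ideal.Quotient.field q
      have h0 := hdim.trans hqdim
      rw [ringKrullDim_eq_zero_of_field, hn] at h0
      norm_cast at h0
    classical
    have hperm := List.perm_cons_erase hr
    have h' : Ideal.ofList (r :: rs.erase r) = maximalIdeal A := by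
      rw [← h]
      exact congrArg Ideal.span (Set.ext fun a => hperm.symm.mem_iff)
    rw [hperm.length_eq] at hdim
    obtain ⟨hloc, hmax, hdim'⟩ := ringKrullDim_quotient_eq_length h' hdim
    have hlen : (rs.erase r).length = n := by
      have := hperm.length_eq
      simp only [List.length_cons] at this
      omega
    have hdom := ih _ _ (by simpa using hlen) hmax hdim'
    have hrm : r ∈ maximalIdeal A := h ▸ Ideal.subset_span hr
    -- Otherwise `A ⧸ (q, r)` is a proper quotient of the domain `A ⧸ (r)`, so its dimension is at
    -- most `n - 1`, and `A ⧸ q` has dimension at most `n`, against the lower bound `n + 1`.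
    have hqr : q ≤ Ideal.span {r} := by
      by_contra hcon
      obtain ⟨z, hz, hzr⟩ := SetLike.not_le_iff_exists.1 hcon
      have := isLocalRing_quotient hqm
      have h1 : ringKrullDim (A ⧸ q) ≤ _ :=
        ringKrullDim_le_quotient_span_singleton_add_one (r := Ideal.Quotient.mk q r)
          (by rw [← IsLocalRing.map_maximalIdeal_of_surjective _ (Ideal.Quotient.mk_surjective (I := q))]
              exact Ideal.mem_map_of_mem _ hrm)
      let f : A ⧸ Ideal.span {r} →+* (A ⧸ q) ⧸ Ideal.span {Ideal.Quotient.mk q r} :=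
        Ideal.Quotient.lift _ ((Ideal.Quotient.mk _).comp (Ideal.Quotient.mk q)) (by
          intro a ha
          obtain ⟨b, rfl⟩ := Ideal.mem_span_singleton'.1 ha
          rw [RingHom.comp_apply, Ideal.Quotient.eq_zero_iff_mem, map_mul]
          exact Ideal.mul_mem_left _ _ (Ideal.mem_span_singleton_self _))
      have hf : Function.Surjective f := by
        refine Ideal.Quotient.lift_surjective_of_surjective _ _ ?_
        exact Ideal.Quotient.mk_surjective.comp Ideal.Quotient.mk_surjective
      have h2 := ringKrullDim_succ_le_of_surjective f hf (r := Ideal.Quotient.mk _ z)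
        (mem_nonZeroDivisors_of_ne_zero (by rwa [Ne, Ideal.Quotient.eq_zero_iff_mem]))
        (by
          change Ideal.Quotient.mk _ (Ideal.Quotient.mk q z) = 0
          rw [Ideal.Quotient.eq_zero_iff_mem.2 hz, map_zero])
      have h3 := ringKrullDim_le_length hmax
      have h4 := hdim.trans (hqdim.trans (h1.trans (h2.trans h3)))
      simp only [List.length_cons, List.length_map] at h4
      norm_cast at h4
      omega
    have hq0 : q = ⊥ := by
      refine Submodule.eq_bot_of_le_smul_of_le_jacobson_bot (Ideal.span {r}) q
        (IsNoetherian.noetherian q) (fun a ha => ?_) ?_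
      · obtain ⟨b, rfl⟩ := Ideal.mem_span_singleton'.1 (hqr ha)
        rw [mul_comm]
        exact Submodule.smul_mem_smul (Ideal.mem_span_singleton_self r)
          ((hq.mem_or_mem ha).resolve_right hrq)
      · rw [IsLocalRing.jacobson_eq_maximalIdeal _ bot_ne_top]
        exact (Ideal.span_singleton_le_iff_mem _).2 hrm
    rw [hq0] at hq
    exact (Ideal.Quotient.isDomain_iff_prime _).2 hq |> fun _ =>
      (RingEquiv.quotientBot A).toMulEquiv.symm.isDomain _

/-- The first generator is nonzero, as otherwise fewer elements would generate the maximal ideal,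
hence regular because `A` is a domain; the quotient by it satisfies the same hypotheses. -/
theorem isWeaklyRegular_of_ofList_eq_maximalIdeal (n : ℕ) : ∀ (A : Type u) [CommRing A]
    [IsLocalRing A] [IsNoetherianRing A] (rs : List A), rs.length = n →
    Ideal.ofList rs = maximalIdeal A → (rs.length : WithBot ℕ∞) ≤ ringKrullDim A →
    RingTheory.Sequence.IsWeaklyRegular A rs := by
  induction n with
  | zero =>
    intro A _ _ _ rs hn h _
    obtain rfl := List.eq_nil_of_length_eq_zero hn
    exact .nil A A
  | succ n ih =>
    intro A _ _ _ rs hn h hdim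
    obtain _ | ⟨r, rs⟩ := rs
    · simp at hn
    have hdom := isDomain_of_ofList_eq_maximalIdeal _ A _ rfl h hdim
    obtain ⟨hloc, hmax, hdim'⟩ := ringKrullDim_quotient_eq_length h hdim
    have hr0 : r ≠ 0 := by
      rintro rfl
      have h' : Ideal.ofList rs = maximalIdeal A := by
        rw [← h, Ideal.ofList_cons, Ideal.span_singleton_zero, bot_sup_eq]
      have h1 := hdim.trans (ringKrullDim_le_length h')
      rw [List.length_cons] at h1
      norm_cast at h1
      omega
    have hw := ih _ _ (by simpa using hn) hmax hdim'
    have hw' : RingTheory.Sequence.IsWeaklyRegular (A ⧸ Ideal.span {r}) rs :=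
      (RingTheory.Sequence.isWeaklyRegular_map_algebraMap_iff (R := A)
        (S := A ⧸ Ideal.span {r}) (M := A ⧸ Ideal.span {r}) rs).1 hw
    refine RingTheory.Sequence.IsWeaklyRegular.cons ((IsRegular.of_ne_zero hr0).left.isSMulRegular) ?_
    refine (LinearEquiv.isWeaklyRegular_congr (Submodule.quotEquivOfEq _ _ ?_) rs).1 hw'
    rw [← Submodule.ideal_span_singleton_smul, smul_eq_mul, Ideal.mul_top]

end Regular

/-! ### Regular sequences along exact sequences and filtrations -/

section WeaklyRegular

open RingTheory.Sequence

variable {R : Type*} [CommRing R] {M N Q : Type*} [AddCommGroup M] [AddCommGroup N] [AddCommGroup Q]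
  [Module R M] [Module R N] [Module R Q]

/-- Because `r` is regular on the right-hand term, the short exact sequence stays short exact modulo
`r`, and the induction continues with the rest of the list. -/
theorem isWeaklyRegular_of_exact {f : N →ₗ[R] M} {g : M →ₗ[R] Q} (hf : Function.Injective f)
    (hfg : Function.Exact f g) (hg : Function.Surjective g) {rs : List R}
    (hN : IsWeaklyRegular N rs) (hQ : IsWeaklyRegular Q rs) : IsWeaklyRegular M rs := by
  induction rs generalizing N M Q with
  | nil => exact .nil R M
  | cons r rs ih =>
    rw [isWeaklyRegular_cons_iff] at hN hQ ⊢
    refine ⟨?_, ih (f := QuotSMulTop.map r f) (g := QuotSMulTop.map r g) ?_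
      (QuotSMulTop.map_exact r hfg hg) (QuotSMulTop.map_surjective r hg) hN.2 hQ.2⟩
    · exact isSMulRegular_of_range_eq_ker hf (LinearMap.exact_iff.1 hfg).symm hN.1 hQ.1
    · have h0 : Function.Exact (0 : N →ₗ[R] N) f := by
        rw [LinearMap.exact_iff, LinearMap.range_zero, LinearMap.ker_eq_bot.2 hf]
      have := QuotSMulTop.map_first_exact_on_four_term_exact_of_isSMulRegular_last h0 hfg hQ.1
      rw [map_zero, LinearMap.exact_iff, LinearMap.range_zero] at this
      exact LinearMap.ker_eq_bot.1 this

/-- Regularity on `M ⧸ N` keeps `N → M` injective after reduction modulo the sequence, a vanishing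
of `Tor₁`. -/
theorem ofList_smul_top_inf_le {N : Submodule R M} {rs : List R}
    (h : IsWeaklyRegular (M ⧸ N) rs) :
    Ideal.ofList rs • (⊤ : Submodule R M) ⊓ N ≤ Ideal.ofList rs • N := by
  rintro x ⟨hx, hxN⟩
  have h0 : Function.Exact (0 : N →ₗ[R] N) N.subtype := by
    rw [LinearMap.exact_iff, LinearMap.range_zero, Submodule.ker_subtype]
  have hex : Function.Exact N.subtype N.mkQ := by
    rw [LinearMap.exact_iff, Submodule.ker_mkQ, Submodule.range_subtype]
  have := map_first_exact_on_four_term_right_exact_of_isSMulRegular_last h0 hex N.mkQ_surjective h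
  obtain ⟨y, hy⟩ := (this (Submodule.Quotient.mk ⟨x, hxN⟩)).1 (by
    rw [Submodule.mapQ_apply, Submodule.Quotient.mk_eq_zero]
    exact hx)
  obtain ⟨y, rfl⟩ := Submodule.Quotient.mk_surjective _ y
  rw [Submodule.mapQ_apply, LinearMap.zero_apply, Submodule.Quotient.mk_zero, eq_comm,
    Submodule.Quotient.mk_eq_zero] at hy
  have := Submodule.mem_map_of_mem (f := N.subtype) hy
  rwa [Submodule.map_smul'', Submodule.map_top, Submodule.range_subtype] at this

theorem isWeaklyRegular_of_free {I : Ideal R} [Module (R ⧸ I) M] [IsScalarTower R (R ⧸ I) M]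
    [Module.Free (R ⧸ I) M] {rs : List R} (h : IsWeaklyRegular (R ⧸ I) rs) :
    IsWeaklyRegular M rs := by
  rw [← isWeaklyRegular_map_algebraMap_iff (R := R) (S := R ⧸ I)] at h ⊢
  exact (LinearEquiv.isWeaklyRegular_congr (TensorProduct.rid (R ⧸ I) M) _).1
    (h.isWeaklyRegular_lTensor (M₂ := M))

/-- Filter by powers of `I`: each graded piece is free over `R ⧸ I`, hence inherits regularity, and
`0 → Iⁿ/Iⁿ⁺¹ → R/Iⁿ⁺¹ → R/Iⁿ → 0` passes it on. Only the pieces below `n` are involved, which lets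
freeness of the `n`-th piece be proved by strong induction. -/
theorem isWeaklyRegular_quotient_pow {I : Ideal R} {rs : List R}
    (h : IsWeaklyRegular (R ⧸ I) rs) (n : ℕ)
    (hfree : ∀ k < n, Module.Free (R ⧸ I) (gradedPiece I k)) :
    IsWeaklyRegular (R ⧸ I ^ n) rs := by
  induction n with
  | zero =>
    have : Subsingleton (R ⧸ I ^ 0) := by
      rw [pow_zero, Ideal.one_eq_top]
      exact Ideal.Quotient.subsingleton_iff.2 rfl
    exact ⟨fun i hi => Function.injective_of_subsingleton _⟩
  | succ n ih =>
    have hn := ih fun k hk => hfree k (hk.trans n.lt_succ_self)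
    have := hfree n n.lt_succ_self
    have hpiece : IsWeaklyRegular (gradedPiece I n) rs := isWeaklyRegular_of_free h
    have hle : I • (⊤ : Submodule R ↥(I ^ n)) ≤
        Submodule.comap (I ^ n).subtype (I ^ (n + 1)) := fun a ha =>
      (gradedPiece_mk_eq_zero_iff a).1 ((Submodule.Quotient.mk_eq_zero _).2 ha)
    refine isWeaklyRegular_of_exact (f := Submodule.mapQ _ _ (I ^ n).subtype hle)
      (g := Submodule.mapQ (I ^ (n + 1)) (I ^ n) LinearMap.id (Ideal.pow_le_pow_right n.le_succ))
      ?_ ?_ ?_ hpiece hn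
    · rw [← LinearMap.ker_eq_bot, LinearMap.ker_eq_bot']
      intro m hm
      obtain ⟨a, rfl⟩ := Submodule.Quotient.mk_surjective _ m
      rw [Submodule.mapQ_apply, Submodule.Quotient.mk_eq_zero] at hm
      exact (gradedPiece_mk_eq_zero_iff a).2 hm
    · intro m
      obtain ⟨a, rfl⟩ := Submodule.Quotient.mk_surjective _ m
      rw [Submodule.mapQ_apply, Submodule.Quotient.mk_eq_zero]
      constructor
      · exact fun ha => ⟨Submodule.Quotient.mk ⟨a, ha⟩, rfl⟩
      · rintro ⟨b, hb⟩
        obtain ⟨b, rfl⟩ := Submodule.Quotient.mk_surjective _ b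
        rw [Submodule.mapQ_apply, Submodule.Quotient.eq] at hb
        have := (Submodule.sub_mem_iff_right _ b.2).1 (Ideal.pow_le_pow_right n.le_succ hb)
        exact this
    · intro m
      obtain ⟨a, rfl⟩ := Submodule.Quotient.mk_surjective _ m
      exact ⟨Submodule.Quotient.mk a, rfl⟩

end WeaklyRegular

/-! ### Dimension of quotients and lifting of parameters -/

section Dimension

theorem ringKrullDim_quotient_nilradical (B : Type*) [CommRing B] :
    ringKrullDim (B ⧸ nilradical B) = ringKrullDim B := by
  have h : PrimeSpectrum.zeroLocus (nilradical B : Set B) = Set.univ :=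
    Set.eq_univ_of_forall fun p => nilradical_le_prime p.asIdeal
  rw [ringKrullDim_quotient, h]
  exact Order.krullDim_eq_of_orderIso OrderIso.Set.univ

theorem height_add_ringKrullDim_quotient_le {B : Type*} [CommRing B] (P : Ideal B) [hP : P.IsPrime] :
    (P.height : WithBot ℕ∞) + ringKrullDim (B ⧸ P) ≤ ringKrullDim B := by
  let p : PrimeSpectrum B := ⟨P, hP⟩
  have h1 : P.height = Order.height p := p.height_eq_orderHeight
  have h2 : ringKrullDim (B ⧸ P) = (Order.coheight p : WithBot ℕ∞) := by
    rw [ringKrullDim_quotient, Order.coheight_eq_krullDim_Ici]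
    rfl
  have : Nonempty (PrimeSpectrum B) := ⟨p⟩
  rw [h1, h2, ringKrullDim, Order.krullDim_eq_iSup_height_add_coheight_of_nonempty]
  norm_cast
  exact le_iSup (fun q : PrimeSpectrum B => Order.height q + Order.coheight q) p

theorem exists_list_sup_ker_eq_maximalIdeal {B E : Type*} [CommRing B] [IsLocalRing B]
    [CommRing E] [IsRegularLocalRing E] (g : B →+* E) (hg : Function.Surjective g) :
    ∃ xs : List B, Ideal.ofList xs ⊔ RingHom.ker g = maximalIdeal B ∧
      (xs.length : WithBot ℕ∞) = ringKrullDim (B ⧸ RingHom.ker g) := by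
  obtain ⟨s, hcard, hs⟩ := Submodule.FG.exists_span_finset_card_eq_spanFinrank
    (IsNoetherian.noetherian (maximalIdeal E))
  have hmap : (maximalIdeal B).map g = maximalIdeal E :=
    IsLocalRing.map_maximalIdeal_of_surjective _ hg
  have hker : RingHom.ker g ≤ maximalIdeal B := le_maximalIdeal (RingHom.ker_ne_top g)
  refine ⟨s.toList.map (Function.surjInv hg), ?_, ?_⟩
  · have hlist : (Ideal.ofList (s.toList.map (Function.surjInv hg))).map g = maximalIdeal E := by
      rw [Ideal.map_ofList, List.map_map, ← hs]
      have : (g : B → E) ∘ Function.surjInv hg = id := funext (Function.surjInv_eq hg)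
      rw [this, List.map_id]
      exact congrArg Ideal.span (Set.ext fun a => by simp)
    have h1 := Ideal.comap_map_of_surjective' g hg (Ideal.ofList (s.toList.map (Function.surjInv hg)))
    have h2 := Ideal.comap_map_of_surjective' g hg (maximalIdeal B)
    rw [hlist] at h1
    rw [hmap, sup_eq_left.2 hker] at h2
    rw [← h1, h2]
  · rw [List.length_map, Finset.length_toList, hcard, IsRegularLocalRing.spanFinrank_maximalIdeal]
    exact (ringKrullDim_eq_of_ringEquiv (RingHom.quotientKerEquivOfSurjective hg)).symm

end Dimension

/-! ### From the localization at `P` and the quotient by `(y)` back to `B` -/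

section Descent

variable {B : Type u} [CommRing B] {P : Ideal B} [P.IsPrime] {ys : List B}

/-- The nilradical of `B ⧸ (ys)`, when `P = (ys) + nil B` is prime. -/
theorem map_mk_eq_nilradical (hP : P = Ideal.ofList ys ⊔ nilradical B) :
    (nilradical B).map (Ideal.Quotient.mk (Ideal.ofList ys)) =
      nilradical (B ⧸ Ideal.ofList ys) := by
  refine le_antisymm ?_ fun a ha => ?_
  · rw [Ideal.map_le_iff_le_comap]
    intro b hb
    exact mem_nilradical.2 ((mem_nilradical.1 hb).map _)
  · obtain ⟨b, rfl⟩ := Ideal.Quotient.mk_surjective a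
    obtain ⟨n, hn⟩ := mem_nilradical.1 ha
    rw [← map_pow, Ideal.Quotient.eq_zero_iff_mem] at hn
    have hbP : b ∈ P := (inferInstance : P.IsPrime).mem_of_pow_mem n
      (hP ▸ Ideal.mem_sup_left hn)
    rw [hP, Submodule.mem_sup] at hbP
    obtain ⟨y, hy, z, hz, rfl⟩ := hbP
    rw [map_add, Ideal.Quotient.eq_zero_iff_mem.2 hy, zero_add]
    exact Ideal.mem_map_of_mem _ hz

theorem mk_mem_nilradical_iff (hP : P = Ideal.ofList ys ⊔ nilradical B) (b : B) :
    Ideal.Quotient.mk (Ideal.ofList ys) b ∈ nilradical (B ⧸ Ideal.ofList ys) ↔ b ∈ P := by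
  rw [← map_mk_eq_nilradical hP, Ideal.mem_quotient_iff_mem_sup, hP, sup_comm]

/-- The reduction of `B ⧸ (y)` is `B ⧸ P`. Together with lifts of a regular system of parameters of
`B ⧸ P`, the `y` generate the maximal ideal modulo nilpotents, and their total number is at most
`height P + dim B/P ≤ dim B`. This gives both conclusions. -/
theorem isRegularLocalRing_and_isWeaklyRegular [IsLocalRing B] [IsNoetherianRing B]
    (hP : P = Ideal.ofList ys ⊔ nilradical B)
    (hheight : (ys.length : WithBot ℕ∞) ≤ P.height)
    (hS : IsRegularLocalRing ((B ⧸ Ideal.ofList ys) ⧸ nilradical (B ⧸ Ideal.ofList ys))) :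
    IsRegularLocalRing (B ⧸ nilradical B) ∧
      RingTheory.Sequence.IsWeaklyRegular (B ⧸ nilradical B) ys := by
  let g : B →+* (B ⧸ Ideal.ofList ys) ⧸ nilradical (B ⧸ Ideal.ofList ys) :=
    (Ideal.Quotient.mk _).comp (Ideal.Quotient.mk _)
  have hg : Function.Surjective g :=
    Ideal.Quotient.mk_surjective.comp Ideal.Quotient.mk_surjective
  have hker : RingHom.ker g = P := by
    ext b
    rw [← mk_mem_nilradical_iff hP, RingHom.mem_ker]
    exact Ideal.Quotient.eq_zero_iff_mem
  obtain ⟨xs, hxs, hlen⟩ := exists_list_sup_ker_eq_maximalIdeal g hg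
  rw [hker] at hxs hlen
  have hnil : nilradical B ≤ maximalIdeal B := nilradical_le_prime _
  have hloc : IsLocalRing (B ⧸ nilradical B) := isLocalRing_quotient hnil
  have hmax : Ideal.ofList ((ys ++ xs).map (algebraMap B (B ⧸ nilradical B))) =
      maximalIdeal (B ⧸ nilradical B) := by
    rw [← IsLocalRing.map_maximalIdeal_of_surjective (Ideal.Quotient.mk (nilradical B))
      Ideal.Quotient.mk_surjective, ← hxs, hP, ← Ideal.map_ofList, Ideal.ofList_append,
      Ideal.map_sup, Ideal.map_sup, Ideal.map_sup, Ideal.map_quotient_self, sup_bot_eq, sup_comm]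
    rfl
  have hdim : (((ys ++ xs).map (algebraMap B (B ⧸ nilradical B))).length : WithBot ℕ∞) ≤
      ringKrullDim (B ⧸ nilradical B) := by
    rw [List.length_map, List.length_append, Nat.cast_add, hlen, ringKrullDim_quotient_nilradical]
    exact (add_le_add_left hheight _).trans (height_add_ringKrullDim_quotient_le P)
  constructor
  · refine IsRegularLocalRing.of_spanFinrank_maximalIdeal_le _ (le_trans ?_ hdim)
    rw [← hmax]
    exact_mod_cast spanFinrank_ofList_le _
  · have := isWeaklyRegular_of_ofList_eq_maximalIdeal _ _ _ rfl hmax hdim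
    rw [RingTheory.Sequence.isWeaklyRegular_map_algebraMap_iff,
      RingTheory.Sequence.isWeaklyRegular_append_iff] at this
    exact this.1

theorem map_nilradical_of_isLocalization {B : Type*} [CommRing B] (S : Submonoid B) (C : Type*)
    [CommRing C] [Algebra B C] [IsLocalization S C] :
    (nilradical B).map (algebraMap B C) = nilradical C := by
  refine le_antisymm ?_ fun c hc => ?_
  · rw [Ideal.map_le_iff_le_comap]
    intro b hb
    exact mem_nilradical.2 ((mem_nilradical.1 hb).map _)
  · obtain ⟨⟨b, s⟩, hbs⟩ := IsLocalization.surj S c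
    obtain ⟨n, hn⟩ := mem_nilradical.1 hc
    have h0 : algebraMap B C (b ^ n) = 0 := by
      rw [map_pow, ← hbs, mul_pow, hn, zero_mul]
    obtain ⟨m, hm⟩ := (IsLocalization.map_eq_zero_iff S C _).1 h0
    have : (m : B) * b ∈ nilradical B := by
      refine mem_nilradical.2 ⟨n + 1, ?_⟩
      calc ((m : B) * b) ^ (n + 1) = (m : B) ^ n * b * (m * b ^ n) := by ring
        _ = 0 := by rw [hm, mul_zero]
    have h1 := Ideal.mem_map_of_mem (algebraMap B C) this
    rw [map_mul, Ideal.unit_mul_mem_iff_mem _ (IsLocalization.map_units C m), ← hbs, mul_comm,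
      Ideal.unit_mul_mem_iff_mem _ (IsLocalization.map_units C s)] at h1
    exact h1

variable {C : Type*} [CommRing C] [Algebra B C] [IsLocalization.AtPrime C P]

theorem algebraMap_mem_nilradical_pow_iff (n : ℕ) (b : B) :
    algebraMap B C b ∈ nilradical C ^ n ↔ ∃ s ∉ P, s * b ∈ nilradical B ^ n := by
  rw [← map_nilradical_of_isLocalization P.primeCompl C, ← Ideal.map_pow,
    IsLocalization.algebraMap_mem_map_algebraMap_iff P.primeCompl C]
  rfl

/-- A lift to `Iⁿ` of a basis of a graded piece of the nilradical of `B ⧸ (ys)`. -/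
theorem exists_lift_isGradedBasis (hP : P = Ideal.ofList ys ⊔ nilradical B) {n r : ℕ}
    {x : Fin r → B ⧸ Ideal.ofList ys}
    (hx : IsGradedBasis (nilradical (B ⧸ Ideal.ofList ys)) n x) :
    ∃ z : Fin r → B, (∀ i, z i ∈ nilradical B ^ n) ∧
      (nilradical B ^ n ≤
        Ideal.span (Set.range z) ⊔ nilradical B ^ (n + 1) ⊔ (Ideal.ofList ys ⊓ nilradical B ^ n)) ∧
      ∀ c : Fin r → B, ∑ i, c i * z i ∈ nilradical B ^ (n + 1) ⊔ Ideal.ofList ys →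
        ∀ i, c i ∈ P := by
  have hmem := hx.mem
  simp_rw [← map_mk_eq_nilradical hP, ← Ideal.map_pow] at hmem
  choose z hz hzx using fun i =>
    (Ideal.mem_map_iff_of_surjective _ Ideal.Quotient.mk_surjective).1 (hmem i)
  obtain rfl : x = fun i => Ideal.Quotient.mk _ (z i) := funext fun i => (hzx i).symm
  have key : ∀ k b, Ideal.Quotient.mk (Ideal.ofList ys) b ∈ nilradical (B ⧸ Ideal.ofList ys) ^ k ↔
      b ∈ nilradical B ^ k ⊔ Ideal.ofList ys := fun k b => by
    rw [← map_mk_eq_nilradical hP, ← Ideal.map_pow, Ideal.mem_quotient_iff_mem_sup]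
  refine ⟨z, hz, fun f hf => ?_, fun c hc i => ?_⟩
  · obtain ⟨c, hc⟩ := exists_eq_sum_add (hx.le_span ((key n f).2 (Ideal.mem_sup_left hf)))
    obtain ⟨c, rfl⟩ : ∃ c', c = fun i => Ideal.Quotient.mk _ (c' i) :=
      ⟨fun i => Function.surjInv Ideal.Quotient.mk_surjective (c i),
        funext fun i => (Function.surjInv_eq _ _).symm⟩
    have : f - ∑ i, c i * z i ∈ nilradical B ^ (n + 1) ⊔ Ideal.ofList ys :=
      (key _ _).1 (by simpa using hc)
    obtain ⟨g, hg, y, hy, hgy⟩ := Submodule.mem_sup.1 this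
    have hsum : ∑ i, c i * z i ∈ nilradical B ^ n :=
      Ideal.sum_mem _ fun i _ => Ideal.mul_mem_left _ _ (hz i)
    have hf' : f = ∑ i, c i * z i + g + y := by rw [add_assoc, hgy]; ring
    -- The error term in `(y)` lies in `Iⁿ` as well, since everything else in the equation does.
    -- This intersection is what regularity of the sequence will control.
    have hyn : y ∈ nilradical B ^ n := by
      have : y = f - ∑ i, c i * z i - g := by rw [hf']; ring
      rw [this]
      exact Ideal.sub_mem _ (Ideal.sub_mem _ hf hsum) (Ideal.pow_le_pow_right n.le_succ hg)
    rw [hf']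
    exact Ideal.add_mem _ (Ideal.mem_sup_left (Ideal.add_mem _
      (Ideal.mem_sup_left (sum_mul_mem_span c z)) (Ideal.mem_sup_right hg)))
      (Ideal.mem_sup_right ⟨hy, hyn⟩)
  · rw [← mk_mem_nilradical_iff hP]
    exact hx.indep (fun i => Ideal.Quotient.mk _ (c i)) (by simpa using (key _ _).2 hc) i

/-- Comparison of ranks: the rank of a graded piece along `(ys)` is at most the generic rank. -/
theorem le_of_isGradedBasis_localization (hP : P = Ideal.ofList ys ⊔ nilradical B) {n r ρ : ℕ}
    {z : Fin r → B} (hz : ∀ i, z i ∈ nilradical B ^ n)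
    (hindep : ∀ c : Fin r → B, ∑ i, c i * z i ∈ nilradical B ^ (n + 1) ⊔ Ideal.ofList ys →
        ∀ i, c i ∈ P)
    {w : Fin ρ → C} (hw : IsGradedBasis (nilradical C) n w) : r ≤ ρ := by
  have hloc := hw.mem
  simp_rw [← map_nilradical_of_isLocalization P.primeCompl C, ← Ideal.map_pow,
    IsLocalization.mem_map_algebraMap_iff P.primeCompl C] at hloc
  choose vs hvs using hloc
  have hspan : ∀ i, ∃ s ∉ P, s * z i ∈
      Ideal.span (Set.range fun j => ((vs j).1 : B)) ⊔ nilradical B ^ (n + 1) := by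
    intro i
    have h1 : algebraMap B C (z i) ∈
        (Ideal.span (Set.range fun j => ((vs j).1 : B)) ⊔ nilradical B ^ (n + 1)).map
          (algebraMap B C) := by
      have h2 : algebraMap B C (z i) ∈ nilradical C ^ n :=
        (algebraMap_mem_nilradical_pow_iff (P := P) n _).2
          ⟨1, (Ideal.ne_top_iff_one P).1 (Ideal.IsPrime.ne_top'), by simpa using hz i⟩
      suffices Ideal.span (Set.range w) ⊔ nilradical C ^ (n + 1) ≤
          (Ideal.span (Set.range fun j => ((vs j).1 : B)) ⊔ nilradical B ^ (n + 1)).map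
            (algebraMap B C) from this (hw.le_span h2)
      refine sup_le ?_ ?_
      · rw [Ideal.span_le]
        rintro _ ⟨j, rfl⟩
        have := Ideal.mem_map_of_mem (algebraMap B C) (Ideal.mem_sup_left
          (T := nilradical B ^ (n + 1))
          (Ideal.subset_span (Set.mem_range_self (f := fun j => ((vs j).1 : B)) j)))
        rw [← hvs j, mul_comm, Ideal.unit_mul_mem_iff_mem _ (IsLocalization.map_units C _)] at this
        exact this
      · rw [← map_nilradical_of_isLocalization P.primeCompl C, ← Ideal.map_pow]
        exact Ideal.map_mono le_sup_right
    obtain ⟨s, hs, h⟩ := (IsLocalization.algebraMap_mem_map_algebraMap_iff P.primeCompl C _ _).1 h1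
    exact ⟨s, hs, h⟩
  choose s hs hsz using hspan
  choose a ha using fun i => exists_eq_sum_add (hsz i)
  -- The matrix writes the `s i * z i` in terms of the `ρ` numerators. It is injective over `B ⧸ P`:
  -- a vector in its kernel gives a relation among the `z i` modulo `Iⁿ⁺¹ + (y)`, because `P Iⁿ` is
  -- contained there.
  let f : (Fin r → B ⧸ P) →ₗ[B ⧸ P] (Fin ρ → B ⧸ P) :=
    ((Matrix.of a).map (Ideal.Quotient.mk P)).vecMulLinear
  refine le_of_fin_injective (B ⧸ P) f (LinearMap.ker_eq_bot.1 (LinearMap.ker_eq_bot'.2 ?_))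
  intro c hc
  obtain ⟨c, rfl⟩ : ∃ c', c = fun i => Ideal.Quotient.mk _ (c' i) :=
    ⟨fun i => Function.surjInv Ideal.Quotient.mk_surjective (c i),
      funext fun i => (Function.surjInv_eq _ _).symm⟩
  have hcP : ∀ j, ∑ i, c i * a i j ∈ P := fun j => by
    have := congrFun hc j
    rw [← Ideal.Quotient.eq_zero_iff_mem, map_sum]
    simpa [f, Matrix.vecMul, dotProduct] using this
  have hmemP : ∀ p ∈ P, ∀ b ∈ nilradical B ^ n, p * b ∈ nilradical B ^ (n + 1) ⊔ Ideal.ofList ys := by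
    intro p hp b hb
    rw [hP, Submodule.mem_sup] at hp
    obtain ⟨y, hy, q, hq, rfl⟩ := hp
    rw [add_mul]
    refine Ideal.add_mem _ (Ideal.mem_sup_right (Ideal.mul_mem_right _ _ hy)) (Ideal.mem_sup_left ?_)
    rw [pow_succ']
    exact Ideal.mul_mem_mul hq hb
  have hsum : ∑ i, (c i * s i) * z i ∈ nilradical B ^ (n + 1) ⊔ Ideal.ofList ys := by
    have : ∑ i, (c i * s i) * z i = ∑ i, c i * (s i * z i - ∑ j, a i j * (vs j).1) +
        ∑ j, (∑ i, c i * a i j) * (vs j).1 := by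
      simp_rw [mul_sub, Finset.sum_sub_distrib, Finset.mul_sum, Finset.sum_mul]
      rw [Finset.sum_comm (f := fun j i => c i * a i j * _)]
      simp [mul_assoc]
    rw [this]
    exact Ideal.add_mem _ (Ideal.mem_sup_left
      (Ideal.sum_mem _ fun i _ => Ideal.mul_mem_left _ _ (ha i)))
      (Ideal.sum_mem _ fun j _ => hmemP _ (hcP j) _ (vs j).1.2)
  funext i
  exact Ideal.Quotient.eq_zero_iff_mem.2
    (((inferInstance : P.IsPrime).mem_or_mem (hindep _ hsum i)).resolve_right (hs i))

-- Over `C`, at most `ρ` generators of a free graded piece of rank `ρ` must form a basis. So a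
-- relation over `B` has coefficients that become nilpotent in `C`; since the nilradical of `B` is
-- prime and contained in `P`, they are already nilpotent in `B`.
variable (P) in
theorem isGradedBasis_of_localization (hI : (nilradical B).IsPrime) {n r ρ : ℕ} {z : Fin r → B}
    (hz : ∀ i, z i ∈ nilradical B ^ n) (hspan : nilradical B ^ n ≤ Ideal.span (Set.range z))
    {C : Type*} [CommRing C] [Algebra B C] [IsLocalization.AtPrime C P]
    {w : Fin ρ → C} (hw : IsGradedBasis (nilradical C) n w) (hr : r ≤ ρ) :
    IsGradedBasis (nilradical B) n z := by
  refine ⟨hz, hspan.trans le_sup_left, fun c hc => ?_⟩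
  have hmap : ∀ k, ∀ b ∈ nilradical B ^ k, algebraMap B C b ∈ nilradical C ^ k := fun k b hb => by
    rw [← map_nilradical_of_isLocalization P.primeCompl C, ← Ideal.map_pow]
    exact Ideal.mem_map_of_mem _ hb
  choose d hd using fun i => exists_eq_sum_add (hw.le_span (hmap n _ (hz i)))
  have hwz : ∀ j, ∃ e : Fin r → C, w j = ∑ i, e i * algebraMap B C (z i) := fun j => by
    have h1 : w j ∈ Ideal.span (Set.range fun i => algebraMap B C (z i)) := by
      have h2 := hw.mem j
      rw [← map_nilradical_of_isLocalization P.primeCompl C, ← Ideal.map_pow] at h2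
      have h3 := Ideal.map_mono (f := algebraMap B C) hspan h2
      rwa [Ideal.map_span, ← Set.range_comp] at h3
    obtain ⟨e, he⟩ := Ideal.mem_span_range_iff_exists_fun.1 h1
    exact ⟨e, he.symm⟩
  choose e he using hwz
  let E : Matrix (Fin ρ) (Fin r) (C ⧸ nilradical C) := (Matrix.of e).map (Ideal.Quotient.mk _)
  let D : Matrix (Fin r) (Fin ρ) (C ⧸ nilradical C) := (Matrix.of d).map (Ideal.Quotient.mk _)
  -- `E` writes the basis `w` in the generators `z`, and `D` writes `z` in `w` modulo the next
  -- power. Independence of `w` makes the composite the identity, so `D` is onto, whence `r = ρ` and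
  -- `D` is also injective.
  have hED : E * D = 1 := by
    ext j k
    have h1 : ∑ k, (∑ i, e j i * d i k - (1 : Matrix (Fin ρ) (Fin ρ) C) j k) * w k ∈
        nilradical C ^ (n + 1) := by
      have : ∑ k, (∑ i, e j i * d i k - (1 : Matrix (Fin ρ) (Fin ρ) C) j k) * w k =
          - ∑ i, e j i * (algebraMap B C (z i) - ∑ k, d i k * w k) := by
        simp_rw [sub_mul, mul_sub, Finset.sum_sub_distrib, ← he j, Finset.mul_sum, Finset.sum_mul]
        rw [Finset.sum_comm (f := fun k i => e j i * d i k * w k)]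
        simp [Matrix.one_apply, mul_assoc]
      rw [this]
      exact Submodule.neg_mem _ (Ideal.sum_mem _ fun i _ => Ideal.mul_mem_left _ _ (hd i))
    have h2 := Ideal.Quotient.eq_zero_iff_mem.2 (hw.indep _ h1 k)
    rw [map_sub, sub_eq_zero, map_sum] at h2
    rw [Matrix.mul_apply]
    simpa [E, D, Matrix.one_apply, apply_ite] using h2
  have hnt : Nontrivial (C ⧸ nilradical C) := by
    have : IsLocalRing C := IsLocalization.AtPrime.isLocalRing C P
    exact Ideal.Quotient.nontrivial_iff.2
      (ne_top_of_le_ne_top (maximalIdeal.isMaximal C).ne_top (nilradical_le_prime _))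
  have hsurj : Function.Surjective D.vecMulLinear := fun x =>
    ⟨Matrix.vecMul x E, by simp [Matrix.vecMul_vecMul, hED]⟩
  obtain rfl : r = ρ := le_antisymm hr (le_of_fin_surjective _ _ hsurj)
  have hinj := OrzechProperty.injective_of_surjective_endomorphism _ hsurj
  have hc0 : D.vecMulLinear (fun i => Ideal.Quotient.mk _ (algebraMap B C (c i))) = 0 := by
    funext k
    have h1 : ∑ k, (∑ i, algebraMap B C (c i) * d i k) * w k ∈ nilradical C ^ (n + 1) := by
      have : ∑ k, (∑ i, algebraMap B C (c i) * d i k) * w k = algebraMap B C (∑ i, c i * z i) -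
          ∑ i, algebraMap B C (c i) * (algebraMap B C (z i) - ∑ k, d i k * w k) := by
        simp_rw [mul_sub, Finset.sum_sub_distrib, Finset.mul_sum, Finset.sum_mul]
        rw [Finset.sum_comm (f := fun k i => algebraMap B C (c i) * d i k * w k)]
        simp [mul_assoc]
      rw [this]
      exact Ideal.sub_mem _ (hmap _ _ hc) (Ideal.sum_mem _ fun i _ => Ideal.mul_mem_left _ _ (hd i))
    have h2 := Ideal.Quotient.eq_zero_iff_mem.2 (hw.indep _ h1 k)
    rw [map_sum] at h2
    simpa [D, Matrix.vecMul, dotProduct] using h2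
  intro i
  have h1 := congrFun (hinj (hc0.trans (map_zero _).symm)) i
  have h2 := Ideal.Quotient.eq_zero_iff_mem.1 h1
  rw [← pow_one (nilradical C), algebraMap_mem_nilradical_pow_iff (P := P), pow_one] at h2
  obtain ⟨s, hs, hsc⟩ := h2
  exact (hI.mem_or_mem hsc).resolve_left fun h => hs (nilradical_le_prime P h)

/-- If the localization of `B` at a prime `P = (ys) + nil B` is good, with `ys` inducing a regular
system of parameters of its reduction, and `B ⧸ (ys)` is good, then `B` is good. -/
theorem isGood_of_localization_of_quotient [IsLocalRing B] [IsNoetherianRing B]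
    (hI : (nilradical B).IsPrime)
    (hP : P = Ideal.ofList ys ⊔ nilradical B) (hC : IsGood C)
    (hdim : ringKrullDim C = ys.length) (hS : IsGood (B ⧸ Ideal.ofList ys)) : IsGood B := by
  have hheight : (ys.length : WithBot ℕ∞) ≤ P.height := by
    rw [← hdim, IsLocalization.AtPrime.ringKrullDim_eq_height P C]
  have hPm : P ≤ maximalIdeal B := le_maximalIdeal Ideal.IsPrime.ne_top'
  obtain ⟨hreg, hweak⟩ := isRegularLocalRing_and_isWeaklyRegular hP hheight hS.1
  refine ⟨hreg, fun n => ?_⟩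
  induction n using Nat.strong_induction_on with
  | _ n ih =>
    have : IsNoetherianRing C := IsLocalization.isNoetherianRing P.primeCompl C inferInstance
    obtain ⟨ρ, w, hw⟩ := hC.2.exists_isGradedBasis n
    obtain ⟨r, x, hx⟩ := hS.2.exists_isGradedBasis n
    obtain ⟨z, hz, hspan, hindep⟩ := exists_lift_isGradedBasis hP hx
    have hr := le_of_isGradedBasis_localization hP hz hindep hw
    -- Here the freeness of the lower graded pieces, `ih`, is used.
    have hinf : Ideal.ofList ys ⊓ nilradical B ^ n ≤ Ideal.ofList ys • nilradical B ^ n := by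
      have := ofList_smul_top_inf_le (isWeaklyRegular_quotient_pow hweak n ih)
      rwa [smul_eq_mul, Ideal.mul_top] at this
    refine (isGradedBasis_of_localization P (C := C) hI hz ?_ hw hr).free
    -- Nakayama: both error terms, `Iⁿ⁺¹` and `(y)Iⁿ`, lie in `P Iⁿ`.
    refine Submodule.le_of_le_smul_of_le_jacobson_bot (I := P) (IsNoetherian.noetherian _)
      (by rwa [IsLocalRing.jacobson_eq_maximalIdeal _ bot_ne_top]) (hspan.trans ?_)
    refine sup_le (sup_le le_sup_left ?_) (hinf.trans ?_)
    · rw [pow_succ']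
      exact (Ideal.mul_mono_left (nilradical_le_prime P)).trans le_sup_right
    · exact (Submodule.smul_mono_left (hP ▸ le_sup_left)).trans le_sup_right

end Descent

/-! ### Noetherian subrings with ring of fractions `L`, and their dimension -/

section Subrings

variable {L : Type u} [CommRing L]

/-- The subring generated by `B` and `X`. -/
def adjoin (B : Subring L) (X : Set L) : Subring L := Subring.closure (↑B ∪ X)

theorem le_adjoin (B : Subring L) (X : Set L) : B ≤ adjoin B X := fun _ hx =>
  Subring.subset_closure (Or.inl hx)

theorem subset_adjoin (B : Subring L) (X : Set L) : X ⊆ adjoin B X := fun _ hx =>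
  Subring.subset_closure (Or.inr hx)

theorem adjoin_le_iff {B T : Subring L} {X : Set L} : adjoin B X ≤ T ↔ B ≤ T ∧ X ⊆ T := by
  rw [adjoin, Subring.closure_le, Set.union_subset_iff]
  rfl

theorem adjoin_eq_toSubring (B : Subring L) (X : Set L) :
    adjoin B X = (Algebra.adjoin B X).toSubring := by
  refine le_antisymm (adjoin_le_iff.2 ⟨fun b hb => ?_, Algebra.subset_adjoin⟩) fun x hx => ?_
  · exact (Algebra.adjoin B X).algebraMap_mem ⟨b, hb⟩
  · have hx' : x ∈ Algebra.adjoin B X := hx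
    induction hx' using Algebra.adjoin_induction with
    | mem y hy => exact subset_adjoin B X hy
    | algebraMap b => exact le_adjoin B X b.2
    | add y z _ _ hy hz => exact Subring.add_mem _ (hy ‹_›) (hz ‹_›)
    | mul y z _ _ hy hz => exact Subring.mul_mem _ (hy ‹_›) (hz ‹_›)

theorem adjoin_insert (B : Subring L) (x : L) (X : Set L) :
    adjoin B (insert x X) = adjoin (adjoin B X) {x} := by
  refine le_antisymm (adjoin_le_iff.2 ⟨(le_adjoin B X).trans (le_adjoin _ _), ?_⟩)
    (adjoin_le_iff.2 ⟨adjoin_le_iff.2 ⟨le_adjoin _ _, ?_⟩, ?_⟩)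
  · rintro y (rfl | hy)
    · exact subset_adjoin _ _ rfl
    · exact le_adjoin _ _ (subset_adjoin _ _ hy)
  · exact fun y hy => subset_adjoin _ _ (Or.inr hy)
  · rintro y rfl
    exact subset_adjoin _ _ (Or.inl rfl)

/-- A noetherian subring `T` of `L` such that `L` is a ring of fractions of `T`. -/
structure IsOrder (T : Subring L) : Prop where
  noetherian : IsNoetherianRing T
  surj : ∀ x : L, ∃ s ∈ T, IsUnit s ∧ x * s ∈ T

theorem IsOrder.mem_nonZeroDivisors {T : Subring L} {s : T} (hs : IsUnit (s : L)) :
    s ∈ nonZeroDivisors T := by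
  rw [mem_nonZeroDivisors_iff_right]
  intro x hx
  have := congrArg Subtype.val hx
  exact Subtype.ext ((hs.mul_left_eq_zero).1 this)

theorem IsOrder.adjoin {T : Subring L} (hT : IsOrder T) {X : Set L} (hX : X.Finite) :
    IsOrder (adjoin T X) := by
  refine ⟨?_, fun x => ?_⟩
  · rw [adjoin_eq_toSubring]
    have := hT.noetherian
    exact isNoetherianRing_of_fg (Subalgebra.fg_def.2 ⟨X, hX, rfl⟩)
  · obtain ⟨s, hs, hu, hx⟩ := hT.surj x
    exact ⟨s, le_adjoin _ _ hs, hu, le_adjoin _ _ hx⟩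

/-- `T[x]` is a quotient of `T[X]`, of dimension `dim T + 1`, and the kernel contains `sX - xs` for
a denominator `s` of `x`. This polynomial is a nonzerodivisor because `s` is a unit in `L`, so the
dimension drops by at least one. -/
theorem IsOrder.ringKrullDim_adjoin_singleton_le {T : Subring L} (hT : IsOrder T) (x : L) :
    ringKrullDim (LocalUniformization.adjoin T {x}) ≤ ringKrullDim T := by
  have := hT.noetherian
  rw [adjoin_eq_toSubring, Algebra.adjoin_singleton_eq_range_aeval]
  obtain ⟨s, hs, hu, hx⟩ := hT.surj x
  let p : Polynomial T := Polynomial.C ⟨s, hs⟩ * Polynomial.X - Polynomial.C ⟨x * s, hx⟩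
  have hp : p ∈ nonZeroDivisors (Polynomial T) := by
    rw [Polynomial.mem_nonZeroDivisors_iff]
    intro a ha
    have h1 := congrArg (fun q => Polynomial.coeff q 1) ha
    simp only [p, Polynomial.coeff_smul, Polynomial.coeff_sub, Polynomial.coeff_C_mul,
      Polynomial.coeff_X_one, Polynomial.coeff_C_succ, sub_zero, mul_one, smul_eq_mul,
      Polynomial.coeff_zero] at h1
    exact (mem_nonZeroDivisors_iff_right.1
      (IsOrder.mem_nonZeroDivisors (s := (⟨s, hs⟩ : T)) hu)) a h1
  have h2 := ringKrullDim_succ_le_of_surjective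
    (Polynomial.aeval (R := T) x).rangeRestrict.toRingHom
    (Polynomial.aeval (R := T) x).rangeRestrict_surjective hp (by
      refine Subtype.ext ?_
      change Polynomial.aeval x p = 0
      simp only [p, map_sub, map_mul, Polynomial.aeval_C, Polynomial.aeval_X]
      change s * x - x * s = 0
      ring)
  rw [Polynomial.ringKrullDim_of_isNoetherianRing] at h2
  exact ENat.WithBot.add_le_add_one_right_iff.1 h2

theorem IsOrder.ringKrullDim_adjoin_le {T : Subring L} (hT : IsOrder T) {X : Set L}
    (hX : X.Finite) : ringKrullDim (LocalUniformization.adjoin T X) ≤ ringKrullDim T := by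
  induction X, hX using Set.Finite.induction_on with
  | empty =>
    have : LocalUniformization.adjoin T ∅ = T :=
      le_antisymm (adjoin_le_iff.2 ⟨le_rfl, Set.empty_subset _⟩) (le_adjoin _ _)
    rw [this]
  | @insert x X _ hX ih =>
    rw [adjoin_insert]
    exact ((hT.adjoin hX).ringKrullDim_adjoin_singleton_le x).trans ih

end Subrings

/-! ### Localization at the center of a valuation, inside `L` -/

section Localize

variable {L : Type u} [CommRing L] {Γ : Type v} [AddCommGroup Γ] [LinearOrder Γ]
  [IsOrderedAddMonoid Γ]

/-- The fractions with numerator in `T` and denominator in `T` of value zero. -/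
def localize (ν : AddValuation L (WithTop Γ)) (T : Subring L) : Subring L where
  carrier := {x | ∃ s ∈ T, ν s = 0 ∧ x * s ∈ T}
  mul_mem' := by
    rintro x y ⟨s, hs, hs0, hx⟩ ⟨t, ht, ht0, hy⟩
    refine ⟨s * t, T.mul_mem hs ht, by rw [ν.map_mul, hs0, ht0, add_zero], ?_⟩
    rw [mul_mul_mul_comm]
    exact T.mul_mem hx hy
  add_mem' := by
    rintro x y ⟨s, hs, hs0, hx⟩ ⟨t, ht, ht0, hy⟩
    refine ⟨s * t, T.mul_mem hs ht, by rw [ν.map_mul, hs0, ht0, add_zero], ?_⟩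
    have : (x + y) * (s * t) = x * s * t + y * t * s := by ring
    rw [this]
    exact T.add_mem (T.mul_mem hx ht) (T.mul_mem hy hs)
  neg_mem' := by
    rintro x ⟨s, hs, hs0, hx⟩
    refine ⟨s, hs, hs0, ?_⟩
    rw [neg_mul]
    exact T.neg_mem hx
  one_mem' := ⟨1, T.one_mem, ν.map_one, by simp⟩
  zero_mem' := ⟨1, T.one_mem, ν.map_one, by simp⟩

/-- The affine extension `B[X]` localized at the center of `ν`. -/
def blowup (ν : AddValuation L (WithTop Γ)) (B : Subring L) (X : Set L) : Subring L :=
  localize ν (adjoin B X)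

/-- `ν` is a valuation on a local ring whose support is the maximal ideal, which is nil. -/
structure IsAmbient (ν : AddValuation L (WithTop Γ)) : Prop where
  isUnit : ∀ x, ν x ≠ ⊤ → IsUnit x
  isNilpotent : ∀ x, ν x = ⊤ → IsNilpotent x

variable {ν : AddValuation L (WithTop Γ)}

theorem le_localize (T : Subring L) : T ≤ localize ν T := fun x hx =>
  ⟨1, T.one_mem, ν.map_one, by simpa using hx⟩

theorem localize_mono {T T' : Subring L} (h : T ≤ T') : localize ν T ≤ localize ν T' := by
  rintro x ⟨s, hs, hs0, hx⟩
  exact ⟨s, h hs, hs0, h hx⟩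

theorem val_eq_zero_of_mul {x s : L} (hs : ν s = 0) : ν (x * s) = ν x := by
  rw [ν.map_mul, hs, add_zero]

theorem nonneg_localize {T : Subring L} (h : ∀ x ∈ T, 0 ≤ ν x) : ∀ x ∈ localize ν T, 0 ≤ ν x := by
  rintro x ⟨s, hs, hs0, hx⟩
  rw [← val_eq_zero_of_mul hs0]
  exact h _ hx

theorem localize_localize (T : Subring L) : localize ν (localize ν T) = localize ν T := by
  refine le_antisymm ?_ (le_localize _)
  rintro x ⟨s, ⟨t, ht, ht0, hst⟩, hs0, ⟨r, hr, hr0, hx⟩⟩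
  refine ⟨s * t * r, T.mul_mem hst hr, ?_, ?_⟩
  · rw [ν.map_mul, ν.map_mul, hs0, ht0, hr0, add_zero, add_zero]
  · have : x * (s * t * r) = x * s * r * t := by ring
    rw [this]
    exact T.mul_mem hx ht

theorem localize_le_iff {T T' : Subring L} (h : localize ν T' = T') :
    localize ν T ≤ T' ↔ T ≤ T' :=
  ⟨fun hle => (le_localize T).trans hle, fun hle => h ▸ localize_mono hle⟩

theorem nonneg_adjoin {B : Subring L} {X : Set L} (hB : ∀ x ∈ B, 0 ≤ ν x)
    (hX : ∀ x ∈ X, 0 ≤ ν x) : ∀ x ∈ adjoin B X, 0 ≤ ν x := by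
  intro x hx
  induction hx using Subring.closure_induction with
  | mem y hy => exact hy.elim (hB y) (hX y)
  | zero => simp
  | one => simp
  | add y z _ _ hy hz => exact ν.map_le_add hy hz
  | neg y _ hy => rwa [ν.map_neg]
  | mul y z _ _ hy hz =>
    rw [ν.map_mul]
    exact add_nonneg hy hz

/-- This makes a finite succession of blowing ups a single one, so that uniformization may be proved
after any preliminary blowing up. -/
theorem blowup_blowup (B : Subring L) (X Y : Set L) :
    blowup ν (blowup ν B X) Y = blowup ν B (X ∪ Y) := by
  have hi : ∀ T, localize ν (localize ν T) = localize ν T := localize_localize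
  refine le_antisymm ((localize_le_iff (hi _)).2 (adjoin_le_iff.2 ⟨localize_mono
    (adjoin_le_iff.2 ⟨le_adjoin _ _, fun x hx => subset_adjoin _ _ (Or.inl hx)⟩), fun x hx =>
      le_localize _ (subset_adjoin _ _ (Or.inr hx))⟩)) (localize_mono (adjoin_le_iff.2 ⟨?_, ?_⟩))
  · exact ((le_adjoin B X).trans (le_localize _)).trans (le_adjoin _ _)
  · rintro x (hx | hx)
    · exact le_adjoin _ _ (le_localize _ (subset_adjoin _ _ hx))
    · exact subset_adjoin _ _ hx

theorem localize_adjoin_localize (B : Subring L) (X : Set L) :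
    localize ν (adjoin (localize ν B) X) = localize ν (adjoin B X) := by
  refine le_antisymm ((localize_le_iff (localize_localize _)).2 (adjoin_le_iff.2
    ⟨localize_mono (le_adjoin _ _), (subset_adjoin _ _).trans (le_localize _)⟩))
    (localize_mono (adjoin_le_iff.2 ⟨(le_localize B).trans (le_adjoin _ _), subset_adjoin _ _⟩))

theorem IsAmbient.isUnit_iff (hν : IsAmbient ν) {x : L} : IsUnit x ↔ ν x ≠ ⊤ := by
  refine ⟨fun h htop => ?_, hν.isUnit x⟩
  obtain ⟨y, hy⟩ := h.exists_right_inv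
  have := congrArg ν hy
  rw [ν.map_mul, htop, ν.map_one, top_add] at this
  exact WithTop.top_ne_zero this

theorem IsAmbient.isNilpotent_iff (hν : IsAmbient ν) {x : L} : IsNilpotent x ↔ ν x = ⊤ := by
  refine ⟨fun ⟨n, hn⟩ => ?_, hν.isNilpotent x⟩
  by_contra h
  have h1 := (hν.isUnit x h).pow n
  rw [hν.isUnit_iff, hn, ν.map_zero] at h1
  exact h1 rfl

theorem eq_zero_of_mul_eq_one {x y : L} (hxy : x * y = 1) (hx : ν x = 0) : ν y = 0 := by
  have := congrArg ν hxy
  rwa [ν.map_mul, hx, ν.map_one, zero_add] at this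

/-- A subring `B` of `L` with ring of fractions `L`, noetherian, and local with maximal ideal the
center of `ν`. -/
structure IsModel (ν : AddValuation L (WithTop Γ)) (B : Subring L) : Prop extends IsOrder B where
  nonneg : ∀ x ∈ B, 0 ≤ ν x
  localize_eq : localize ν B = B

section Center

variable {A : Type*} [CommRing A] {T : Subring L} (φ : A →+* L)

/-- The localization of `A` at the center of a valuation is a subring of `L`, for `A → L`
injective. -/
theorem isLocalization_localize (hT : φ.range = T) (hν : IsAmbient ν) (hφ : Function.Injective φ)
    (h : ∀ a, 0 ≤ (ν.comap φ) a) :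
    letI := (φ.codRestrict (localize ν T)
      fun a => le_localize _ (hT ▸ φ.mem_range_self a)).toAlgebra
    IsLocalization.AtPrime (localize ν T) (center (ν.comap φ) h) := by
  let := (φ.codRestrict (localize ν T)
    fun a => le_localize _ (hT ▸ φ.mem_range_self a)).toAlgebra
  have hmap : ∀ a, ((algebraMap A (localize ν T) a : localize ν T) : L) = φ a :=
    fun a => rfl
  have hcompl : ∀ a, a ∈ (center (ν.comap φ) h).primeCompl ↔ ν (φ a) = 0 := fun a => by
    change ¬ (0 < ν (φ a)) ↔ _
    rw [not_lt]
    exact ⟨fun ha => le_antisymm ha (h a), fun ha => ha.le⟩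
  refine (isLocalization_iff _ _).2 ⟨?_, ?_, ?_⟩
  · rintro ⟨s, hs⟩
    rw [hcompl] at hs
    obtain ⟨y, hy⟩ := (hν.isUnit (φ s) (by rw [hs]; exact WithTop.zero_ne_top)).exists_right_inv
    refine IsUnit.of_mul_eq_one ⟨y, φ s, hT ▸ φ.mem_range_self s, hs, ?_⟩ (Subtype.ext hy)
    rw [mul_comm, hy]
    exact Subring.one_mem _
  · subst hT
    rintro ⟨x, _, ⟨s, rfl⟩, hs, ⟨a, ha⟩⟩
    exact ⟨⟨a, ⟨s, (hcompl s).2 hs⟩⟩, Subtype.ext ha.symm⟩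
  · intro a b hab
    exact ⟨1, by rw [hφ (congrArg Subtype.val hab)]⟩

theorem nonempty_localization_center_equiv (hT : φ.range = T) (hν : IsAmbient ν)
    (hφ : Function.Injective φ) (h : ∀ a, 0 ≤ (ν.comap φ) a) :
    Nonempty (Localization.AtPrime (center (ν.comap φ) h) ≃+* localize ν T) := by
  let := (φ.codRestrict (localize ν T)
    fun a => le_localize _ (hT ▸ φ.mem_range_self a)).toAlgebra
  have := isLocalization_localize φ hT hν hφ h
  exact ⟨(IsLocalization.algEquiv (center (ν.comap φ) h).primeCompl
    (Localization.AtPrime (center (ν.comap φ) h)) (localize ν T)).toRingEquiv⟩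

end Center

theorem exists_isLocalization_localize {T : Subring L} (hν : IsAmbient ν)
    (h : ∀ x ∈ T, 0 ≤ ν x) :
    ∃ (P : Ideal T) (_ : P.IsPrime), (∀ x : T, x ∈ P ↔ 0 < ν x) ∧
      letI := (Subring.inclusion (le_localize (ν := ν) T)).toAlgebra
      IsLocalization.AtPrime (localize ν T) P := by
  have h0 : ∀ a, 0 ≤ (ν.comap T.subtype) a := fun a => h a a.2
  exact ⟨center (ν.comap T.subtype) h0, center_isPrime _ h0, fun x => Iff.rfl,
    isLocalization_localize T.subtype T.range_subtype hν Subtype.val_injective h0⟩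

theorem isModel_localize (hν : IsAmbient ν) {T : Subring L} (hT : IsOrder T)
    (h : ∀ x ∈ T, 0 ≤ ν x) : IsModel ν (localize ν T) := by
  obtain ⟨P, hP, -, hloc⟩ := exists_isLocalization_localize hν h
  let := (Subring.inclusion (le_localize (ν := ν) T)).toAlgebra
  have := hT.noetherian
  refine ⟨⟨IsLocalization.isNoetherianRing P.primeCompl _ inferInstance, fun x => ?_⟩,
    nonneg_localize h, localize_localize T⟩
  obtain ⟨s, hs, hu, hx⟩ := hT.surj x
  exact ⟨s, le_localize _ hs, hu, le_localize _ hx⟩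

theorem ringKrullDim_localize_le (hν : IsAmbient ν) {T : Subring L} (h : ∀ x ∈ T, 0 ≤ ν x) :
    ringKrullDim (localize ν T) ≤ ringKrullDim T := by
  obtain ⟨P, hP, -, hloc⟩ := exists_isLocalization_localize hν h
  let := (Subring.inclusion (le_localize (ν := ν) T)).toAlgebra
  rw [IsLocalization.AtPrime.ringKrullDim_eq_height P]
  exact Ideal.height_le_ringKrullDim_of_isPrime

theorem IsModel.blowup (hν : IsAmbient ν) {B : Subring L} (hB : IsModel ν B) {X : Set L}
    (hX : X.Finite) (h : ∀ x ∈ X, 0 ≤ ν x) : IsModel ν (blowup ν B X) :=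
  isModel_localize hν (hB.toIsOrder.adjoin hX) (nonneg_adjoin hB.nonneg h)

theorem IsModel.ringKrullDim_blowup_le (hν : IsAmbient ν) {B : Subring L} (hB : IsModel ν B)
    {X : Set L} (hX : X.Finite) (h : ∀ x ∈ X, 0 ≤ ν x) :
    ringKrullDim (LocalUniformization.blowup ν B X) ≤ ringKrullDim B :=
  (ringKrullDim_localize_le hν (nonneg_adjoin hB.nonneg h)).trans
    (hB.toIsOrder.ringKrullDim_adjoin_le hX)

theorem IsModel.isUnit_iff (hν : IsAmbient ν) {B : Subring L} (hB : IsModel ν B) {b : B} :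
    IsUnit b ↔ ν b = 0 := by
  constructor
  · intro hb
    obtain ⟨c, hc⟩ := hb.exists_right_inv
    have h1 := congrArg (fun x : B => ν x) hc
    simp only [Subring.coe_mul, Subring.coe_one, ν.map_mul, ν.map_one] at h1
    refine le_antisymm ?_ (hB.nonneg b b.2)
    rw [← h1]
    exact le_add_of_nonneg_right (hB.nonneg c c.2)
  · intro hb
    obtain ⟨y, hy⟩ := (hν.isUnit (b : L) (by rw [hb]; exact WithTop.zero_ne_top)).exists_right_inv
    have hyB : y ∈ B := by
      rw [← hB.localize_eq]
      refine ⟨b, b.2, hb, ?_⟩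
      rw [mul_comm, hy]
      exact B.one_mem
    exact IsUnit.of_mul_eq_one ⟨y, hyB⟩ (Subtype.ext hy)

theorem IsAmbient.nontrivial (_hν : IsAmbient ν) : Nontrivial L := by
  refine ⟨⟨0, 1, fun h => ?_⟩⟩
  have := congrArg ν h
  rw [ν.map_zero, ν.map_one] at this
  exact WithTop.top_ne_zero this

theorem IsModel.isLocalRing (hν : IsAmbient ν) {B : Subring L} (hB : IsModel ν B) :
    IsLocalRing B := by
  have := hν.nontrivial
  refine IsLocalRing.of_nonunits_add fun a b ha hb => ?_
  rw [mem_nonunits_iff, hB.isUnit_iff hν] at ha hb ⊢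
  have ha' := lt_of_le_of_ne (hB.nonneg a a.2) (Ne.symm ha)
  have hb' := lt_of_le_of_ne (hB.nonneg b b.2) (Ne.symm hb)
  exact (ν.map_lt_add ha' hb').ne'

theorem IsModel.mem_maximalIdeal_iff (hν : IsAmbient ν) {B : Subring L} (hB : IsModel ν B)
    [IsLocalRing B] {b : B} : b ∈ maximalIdeal B ↔ 0 < ν b := by
  rw [mem_maximalIdeal, mem_nonunits_iff, hB.isUnit_iff hν]
  exact ⟨fun h => lt_of_le_of_ne (hB.nonneg b b.2) (Ne.symm h), fun h => h.ne'⟩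

theorem IsAmbient.mem_nilradical_iff (hν : IsAmbient ν) {B : Subring L} {b : B} :
    b ∈ nilradical B ↔ ν b = ⊤ := by
  rw [mem_nilradical, ← hν.isNilpotent_iff]
  exact (IsNilpotent.map_iff (f := B.subtype) Subtype.val_injective).symm

theorem IsAmbient.isPrime_nilradical (hν : IsAmbient ν) {B : Subring L} :
    (nilradical B).IsPrime := by
  refine ⟨fun h => ?_, fun {x y} hxy => ?_⟩
  · have h1 : (1 : B) ∈ nilradical B := h ▸ Submodule.mem_top
    rw [hν.mem_nilradical_iff] at h1
    simp at h1
  · rw [hν.mem_nilradical_iff] at hxy ⊢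
    rw [hν.mem_nilradical_iff]
    simpa using hxy

end Localize

/-! ### Models obtained from an object of the class stay in the class -/

section Class

variable {L : Type u} [CommRing L] {Γ Γ' : Type v} [AddCommGroup Γ] [LinearOrder Γ]
  [IsOrderedAddMonoid Γ] [AddCommGroup Γ'] [LinearOrder Γ'] [IsOrderedAddMonoid Γ']
  {ν : AddValuation L (WithTop Γ)} {μ : AddValuation L (WithTop Γ')}
  {M : ObjectProperty CommRingCat.{u}}

theorem IsAdmissible.of_ringEquiv (hM : IsAdmissible M) {A A' : Type u} [CommRing A] [CommRing A']
    (e : A ≃+* A') (h : M (.of A)) : M (.of A') := by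
  have := hM.isLocalRing A h
  have : Nontrivial A' := e.injective.nontrivial
  exact hM.of_surjective A A' e e.surjective h

/-- A nonzerodivisor of `B` is not nilpotent, hence has finite value and is a unit of `L`. So `L` is
the total ring of fractions, and finitely generated extensions of `B` inside `L` are birational. -/
theorem IsAmbient.isFractionRing (hν : IsAmbient ν) {B : Subring L} (hB : IsOrder B) :
    IsFractionRing B L := by
  have := hν.nontrivial
  have hunit : ∀ b : B, b ∈ nonZeroDivisors B ↔ IsUnit (b : L) := fun b => by
    refine ⟨fun hb => hν.isUnit_iff.2 fun htop => ?_, IsOrder.mem_nonZeroDivisors⟩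
    rw [← hν.mem_nilradical_iff, mem_nilradical] at htop
    obtain ⟨n, hn⟩ := htop
    exact nonZeroDivisors.ne_zero (pow_mem hb n) hn
  refine (isLocalization_iff _ _).2 ⟨fun b => (hunit b).1 b.2, fun x => ?_, fun {x y} hxy => ?_⟩
  · obtain ⟨s, hs, hu, hx⟩ := hB.surj x
    exact ⟨⟨⟨x * s, hx⟩, ⟨⟨s, hs⟩, (hunit _).2 hu⟩⟩, rfl⟩
  · exact ⟨1, by rw [Subtype.ext hxy]⟩

theorem IsAdmissible.localize_adjoin (hM : IsAdmissible M) (hμ : IsAmbient μ)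
    {B : Subring L} (hB : IsOrder B) {X : Set L} (hX : X.Finite)
    (h : ∀ x ∈ adjoin B X, 0 ≤ μ x) (hMB : M (.of B)) :
    M (.of (localize μ (adjoin B X))) := by
  have := hμ.isFractionRing hB
  let e : FractionRing B ≃ₐ[B] L := FractionRing.algEquiv B L
  let A' : Subalgebra B (FractionRing B) := (Algebra.adjoin B X).map e.symm.toAlgHom
  have hA' : A'.FG := (Subalgebra.fg_def.2 ⟨X, hX, rfl⟩).map _
  let φ : A' →+* L := e.toRingEquiv.toRingHom.comp A'.val.toRingHom
  have hφ : Function.Injective φ := e.injective.comp Subtype.val_injective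
  have hrange : φ.range = adjoin B X := by
    rw [adjoin_eq_toSubring]
    ext x
    constructor
    · rintro ⟨⟨_, ⟨y, hy, rfl⟩⟩, rfl⟩
      change e (e.symm y) ∈ _
      rw [e.apply_symm_apply]
      exact hy
    · intro hx
      exact ⟨⟨e.symm x, ⟨x, hx, rfl⟩⟩, e.apply_symm_apply x⟩
  have h' : ∀ a, 0 ≤ (μ.comap φ) a := fun a => h (φ a) (hrange ▸ φ.mem_range_self a)
  obtain ⟨f⟩ := nonempty_localization_center_equiv φ hrange hμ hφ h'
  exact hM.of_ringEquiv f (hM.of_birational B A' _ hA' hMB)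

theorem IsAdmissible.localize (hM : IsAdmissible M) (hμ : IsAmbient μ)
    {B : Subring L} (hB : IsOrder B) (h : ∀ x ∈ B, 0 ≤ μ x) (hMB : M (.of B)) :
    M (.of (localize μ B)) := by
  have hB' : LocalUniformization.adjoin B ∅ = B :=
      le_antisymm (adjoin_le_iff.2 ⟨le_rfl, Set.empty_subset _⟩) (le_adjoin _ _)
  have := hM.localize_adjoin hμ hB Set.finite_empty (by rwa [hB']) hMB
  rwa [hB'] at this

end Class

/-! ### Local uniformization of a ring versus that of its model in `L` -/

section Uniformization

variable {L : Type u} [CommRing L] {Γ : Type v} [AddCommGroup Γ] [LinearOrder Γ]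
  [IsOrderedAddMonoid Γ] {ν : AddValuation L (WithTop Γ)}

/-- Local uniformization for a model `B` in its ring of fractions `L`. -/
def HasUniformization (ν : AddValuation L (WithTop Γ)) (B : Subring L) : Prop :=
  ∃ X : Set L, X.Finite ∧ (∀ x ∈ X, 0 ≤ ν x) ∧ IsGood (blowup ν B X)

theorem HasUniformization.of_blowup {B : Subring L} {X : Set L} (hX : X.Finite)
    (hX0 : ∀ x ∈ X, 0 ≤ ν x) (h : HasUniformization ν (blowup ν B X)) :
    HasUniformization ν B := by
  obtain ⟨Y, hY, hY0, hgood⟩ := h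
  rw [blowup_blowup] at hgood
  exact ⟨X ∪ Y, hX.union hY, fun x hx => hx.elim (hX0 x) (hY0 x), hgood⟩

section Compare

variable {R : Type u} [CommRing R] {νR : AddValuation R (WithTop Γ)} {φ : R →+* L}

theorem isUnit_map_of_notMem_supp (hν : IsAmbient ν) (hφ : ∀ a, ν (φ a) = νR a) {b : R}
    (hb : b ∉ νR.supp) : IsUnit (φ b) :=
  hν.isUnit _ fun h => hb ((AddValuation.mem_supp_iff νR b).2 (hφ b ▸ h))

theorem extendAway_eq_comap (hφ : ∀ a, ν (φ a) = νR a) {b : R}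
    (hb : b ∉ νR.supp) (hu : IsUnit (φ b)) :
    extendAway νR hb = ν.comap (IsLocalization.Away.lift (S := Localization.Away b) b hu) := by
  ext x
  obtain ⟨⟨a, s⟩, hx⟩ := IsLocalization.surj (Submonoid.powers b) x
  have hs : νR (s : R) ≠ ⊤ := by
    obtain ⟨n, hn⟩ := s.2
    intro h
    rw [← hn] at h
    exact (Submonoid.powers_le (P := (AddValuation.toValuation νR).supp.primeCompl)).2 hb ⟨n, rfl⟩
      ((AddValuation.mem_supp_iff νR _).2 h)
  have h1 := congrArg (extendAway νR hb) hx
  have h2 := congrArg (ν.comap (IsLocalization.Away.lift (S := Localization.Away b) b hu)) hx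
  rw [AddValuation.map_mul, extendAway_algebraMap, extendAway_algebraMap] at h1
  rw [AddValuation.map_mul] at h2
  have hcomap : ∀ y, (ν.comap (IsLocalization.Away.lift (S := Localization.Away b) b hu)) y =
      ν (IsLocalization.Away.lift (S := Localization.Away b) b hu y) := fun _ => rfl
  rw [hcomap, hcomap, hcomap, IsLocalization.Away.lift_eq, IsLocalization.Away.lift_eq, hφ, hφ,
    ← hcomap] at h2
  exact (WithTop.add_right_inj hs).1 (h1.trans h2.symm)

/-- Injectivity of `R_b → L` identifies the affine ring of the blowing up with a subring of `L`,
compatibly with the valuations; both sides then localize at the same center. -/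
theorem nonempty_localRing_equiv (hν : IsAmbient ν) (hφ : ∀ a, ν (φ a) = νR a)
    (D : BlowupData νR) (hu : IsUnit (φ D.b)) (h : ∀ a, 0 ≤ νR a)
    (hinj : Function.Injective (IsLocalization.Away.lift (S := Localization.Away D.b) D.b hu)) :
    Nonempty (D.localRing h ≃+* blowup ν φ.range (Set.range fun i =>
      IsLocalization.Away.lift (S := Localization.Away D.b) D.b hu (frac (D.a i) D.b))) := by
  let ψ := IsLocalization.Away.lift (S := Localization.Away D.b) D.b hu
  let χ : D.affineRing →+* L := ψ.comp D.affineRing.val.toRingHom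
  have hval : D.affineValuation = ν.comap χ := by
    rw [BlowupData.affineValuation, extendAway_eq_comap hφ D.b_notMem hu]
    rfl
  have hrange : χ.range = adjoin φ.range (Set.range fun i => ψ (frac (D.a i) D.b)) := by
    refine le_antisymm ?_ (adjoin_le_iff.2 ⟨?_, ?_⟩)
    · rintro _ ⟨⟨x, hx⟩, rfl⟩
      change ψ x ∈ _
      induction hx using Algebra.adjoin_induction with
      | mem y hy =>
        obtain ⟨i, rfl⟩ := hy
        exact subset_adjoin _ _ ⟨i, rfl⟩
      | algebraMap r => exact le_adjoin _ _ ⟨r, (IsLocalization.Away.lift_eq D.b hu r).symm⟩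
      | add y z _ _ hy hz => rw [map_add]; exact Subring.add_mem _ hy hz
      | mul y z _ _ hy hz => rw [map_mul]; exact Subring.mul_mem _ hy hz
    · rintro _ ⟨r, rfl⟩
      exact ⟨algebraMap R D.affineRing r, IsLocalization.Away.lift_eq D.b hu r⟩
    · rintro _ ⟨i, rfl⟩
      exact ⟨⟨frac (D.a i) D.b, Algebra.subset_adjoin ⟨i, rfl⟩⟩, rfl⟩
  have key : ∀ (μ : AddValuation D.affineRing (WithTop Γ)) (hμ : ∀ x, 0 ≤ μ x),
      μ = ν.comap χ → Nonempty (Localization.AtPrime (center μ hμ) ≃+*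
        blowup ν φ.range (Set.range fun i => ψ (frac (D.a i) D.b))) := by
    rintro _ hμ rfl
    exact nonempty_localization_center_equiv χ hrange hν
      (hinj.comp Subtype.val_injective) hμ
  exact key _ _ hval

end Compare

theorem IsModel.isCenteredValuation (hν : IsAmbient ν) {B : Subring L} (hB : IsModel ν B)
    [IsLocalRing B] : IsCenteredValuation (ν.comap B.subtype) where
  supp_minimal := by
    have hsupp : (ν.comap B.subtype).supp = nilradical B := by
      ext b
      rw [AddValuation.mem_supp_iff, hν.mem_nilradical_iff]
      rfl
    rw [hsupp]
    exact ⟨⟨hν.isPrime_nilradical, bot_le⟩, fun q hq _ =>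
      have := hq.1
      nilradical_le_prime q⟩
  nonneg := fun a => hB.nonneg a a.2
  pos_of_mem := fun a ha => (hB.mem_maximalIdeal_iff hν).1 ha

theorem HasUniformization.of_admits (hν : IsAmbient ν) {B : Subring L} (hB : IsModel ν B)
    [IsLocalRing B] (h : AdmitsLocalUniformization (hB.isCenteredValuation hν)) :
    HasUniformization ν B := by
  obtain ⟨D, hD⟩ := h
  have hφ : ∀ a, ν (B.subtype a) = (ν.comap B.subtype) a := fun _ => rfl
  have hu := isUnit_map_of_notMem_supp hν hφ D.b_notMem
  have hinj : Function.Injective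
      (IsLocalization.Away.lift (S := Localization.Away D.b) D.b hu) := by
    rw [injective_iff_map_eq_zero]
    intro x hx
    obtain ⟨⟨a, s⟩, hxs⟩ := IsLocalization.surj (Submonoid.powers D.b) x
    have h1 := congrArg (IsLocalization.Away.lift (S := Localization.Away D.b) D.b hu) hxs
    rw [map_mul, hx, zero_mul, IsLocalization.Away.lift_eq] at h1
    have h2 : a = 0 := Subtype.ext h1.symm
    rw [h2, map_zero] at hxs
    exact ((IsLocalization.map_units (Localization.Away D.b) s).mul_left_eq_zero).1 hxs
  obtain ⟨e⟩ := nonempty_localRing_equiv hν hφ D hu (hB.isCenteredValuation hν).nonneg hinj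
  rw [B.range_subtype] at e
  have hX0 : ∀ x ∈ Set.range fun i =>
      IsLocalization.Away.lift (S := Localization.Away D.b) D.b hu (frac (D.a i) D.b), 0 ≤ ν x := by
    rintro _ ⟨i, rfl⟩
    have := extendAway_frac_nonneg (ν.comap B.subtype) D.b_notMem (D.le i)
    rwa [extendAway_eq_comap hφ D.b_notMem hu] at this
  have := (hB.blowup hν (Set.finite_range _) hX0).noetherian
  have := isNoetherianRing_of_ringEquiv _ e.symm
  exact ⟨_, Set.finite_range _, hX0, IsGood.of_ringEquiv e hD⟩

section Ambient

variable {R : Type u} [CommRing R] {νR : AddValuation R (WithTop Γ)}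

theorem primeCompl_supp_le (νR : AddValuation R (WithTop Γ)) :
    (AddValuation.toValuation νR).supp.primeCompl ≤ (AddValuation.toValuation νR).supp.primeCompl :=
  le_rfl

/-- The extension of a valuation to the localization of `R` at its support. -/
noncomputable def extendSupp (νR : AddValuation R (WithTop Γ)) :
    AddValuation (Localization.AtPrime (AddValuation.toValuation νR).supp) (WithTop Γ) :=
  AddValuation.ofValuation ((AddValuation.toValuation νR).extendToLocalization
    (primeCompl_supp_le νR) (Localization.AtPrime (AddValuation.toValuation νR).supp))

theorem extendSupp_algebraMap (a : R) : extendSupp νR (algebraMap R _ a) = νR a :=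
  Valuation.extendToLocalization_apply_map_apply _ (primeCompl_supp_le νR) _ a

theorem mem_toValuation_supp (a : R) : a ∈ (AddValuation.toValuation νR).supp ↔ νR a = ⊤ :=
  AddValuation.mem_supp_iff νR a

theorem exists_mul_eq_algebraMap
    (x : Localization.AtPrime (AddValuation.toValuation νR).supp) :
    ∃ a s : R, νR s ≠ ⊤ ∧
      IsUnit (algebraMap R (Localization.AtPrime (AddValuation.toValuation νR).supp) s) ∧
      x * algebraMap R _ s = algebraMap R _ a := by
  obtain ⟨⟨a, s⟩, h⟩ := IsLocalization.surj (AddValuation.toValuation νR).supp.primeCompl x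
  exact ⟨a, s, fun hs => s.2 ((mem_toValuation_supp _).2 hs), IsLocalization.map_units _ s, h⟩

theorem extendSupp_eq_top_iff {x : Localization.AtPrime (AddValuation.toValuation νR).supp}
    {a s : R} (hs : νR s ≠ ⊤) (h : x * algebraMap R _ s = algebraMap R _ a) :
    extendSupp νR x = ⊤ ↔ νR a = ⊤ := by
  have h1 := congrArg (extendSupp νR) h
  rw [AddValuation.map_mul, extendSupp_algebraMap, extendSupp_algebraMap] at h1
  rw [← h1, WithTop.add_eq_top]
  exact ⟨Or.inl, fun h => h.resolve_right hs⟩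

theorem isAmbient_extendSupp [IsLocalRing R] (hνR : IsCenteredValuation νR) :
    IsAmbient (extendSupp νR) := by
  constructor
  · intro x hx
    obtain ⟨a, s, hs, hu, h⟩ := exists_mul_eq_algebraMap x
    rw [Ne, extendSupp_eq_top_iff hs h, ← mem_toValuation_supp] at hx
    have := IsLocalization.map_units (Localization.AtPrime (AddValuation.toValuation νR).supp)
      (⟨a, hx⟩ : (AddValuation.toValuation νR).supp.primeCompl)
    rw [← h] at this
    exact isUnit_of_mul_isUnit_left this
  · intro x hx
    obtain ⟨a, s, hs, hu, h⟩ := exists_mul_eq_algebraMap x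
    rw [extendSupp_eq_top_iff hs h, ← mem_toValuation_supp] at hx
    have h1 := Ideal.mem_map_of_mem
      (algebraMap R (Localization.AtPrime (AddValuation.toValuation νR).supp)) hx
    rw [← h, mul_comm, Ideal.unit_mul_mem_iff_mem _ hu] at h1
    have h2 := IsLocalization.AtPrime.radical_map_of_mem_minimalPrimes
      (Localization.AtPrime (AddValuation.toValuation νR).supp)
      (AddValuation.toValuation νR).supp ⊥ hνR.supp_minimal
    rw [← h2, Ideal.map_bot] at h1
    exact mem_nilradical.1 h1

theorem isModel_extendSupp [IsLocalRing R] [IsNoetherianRing R]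
    (hνR : IsCenteredValuation νR) :
    IsModel (extendSupp νR)
      (algebraMap R (Localization.AtPrime (AddValuation.toValuation νR).supp)).range where
  noetherian := isNoetherianRing_of_surjective _ _ _
    (algebraMap R (Localization.AtPrime (AddValuation.toValuation νR).supp)).rangeRestrict_surjective
  surj := fun x => by
    obtain ⟨a, s, hs, hu, h⟩ := exists_mul_eq_algebraMap x
    exact ⟨_, ⟨s, rfl⟩, hu, ⟨a, h.symm⟩⟩
  nonneg := by
    rintro _ ⟨a, rfl⟩
    rw [extendSupp_algebraMap]
    exact hνR.nonneg a
  localize_eq := by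
    refine le_antisymm ?_ (le_localize _)
    rintro x ⟨_, ⟨s, rfl⟩, hs0, ⟨a, ha⟩⟩
    rw [extendSupp_algebraMap] at hs0
    have hu : IsUnit s := by
      by_contra hcon
      exact (hνR.pos_of_mem s ((mem_maximalIdeal s).2 hcon)).ne' hs0
    obtain ⟨t, ht⟩ := hu.exists_right_inv
    refine ⟨a * t, ?_⟩
    rw [map_mul, ha, mul_assoc, ← map_mul, ht, map_one, mul_one]

/-- The denominator of the blowing up is a product `b₁ * b₀` outside the support: `b₁` is a common
denominator of the elements to adjoin, and `b₀` kills the kernel of `R → L`, so that `R_b` embeds in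
`L`. -/
theorem AdmitsLocalUniformization.of_hasUniformization [IsLocalRing R] [IsNoetherianRing R]
    (hνR : IsCenteredValuation νR)
    (h : HasUniformization (extendSupp νR)
      (algebraMap R (Localization.AtPrime (AddValuation.toValuation νR).supp)).range) :
    AdmitsLocalUniformization hνR := by
  classical
  let L := Localization.AtPrime (AddValuation.toValuation νR).supp
  have hν := isAmbient_extendSupp hνR
  have hB := isModel_extendSupp hνR
  obtain ⟨X, hX, hX0, hgood⟩ := h
  obtain ⟨n, x, rfl⟩ : ∃ (n : ℕ) (x : Fin n → L), Set.range x = X := by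
    obtain ⟨n, e, h⟩ := hX.fin_param
    exact ⟨n, e, h.2⟩
  obtain ⟨⟨b₁, hb₁⟩, hx⟩ := IsLocalization.exist_integer_multiples_of_finite
    (AddValuation.toValuation νR).supp.primeCompl x
  choose a ha using hx
  obtain ⟨b₀, hb₀, hker⟩ : ∃ b₀ ∉ (AddValuation.toValuation νR).supp,
      ∀ r : R, algebraMap R L r = 0 → b₀ * r = 0 := by
    obtain ⟨S, hS⟩ := IsNoetherian.noetherian (RingHom.ker (algebraMap R L))
    have hex : ∀ r : S, ∃ s : (AddValuation.toValuation νR).supp.primeCompl, (s : R) * r = 0 :=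
      fun r => (IsLocalization.map_eq_zero_iff
        (AddValuation.toValuation νR).supp.primeCompl L _).1 (by
          have : (r : R) ∈ RingHom.ker (algebraMap R L) := hS ▸ Ideal.subset_span r.2
          exact this)
    choose s hs using hex
    refine ⟨((∏ r, s r : (AddValuation.toValuation νR).supp.primeCompl) : R),
      (∏ r, s r : (AddValuation.toValuation νR).supp.primeCompl).2, fun r hr => ?_⟩
    have hle : Ideal.span (S : Set R) ≤ LinearMap.ker (LinearMap.mulLeft R
        ((∏ r, s r : (AddValuation.toValuation νR).supp.primeCompl) : R)) := by
      refine Ideal.span_le.2 fun r hr => ?_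
      obtain ⟨c, hc⟩ := Finset.dvd_prod_of_mem s (Finset.mem_univ (⟨r, hr⟩ : S))
      change _ * r = 0
      rw [hc, Submonoid.coe_mul, mul_right_comm, hs ⟨r, hr⟩, zero_mul]
    have hr' : r ∈ RingHom.ker (algebraMap R L) := hr
    rw [← hS] at hr'
    exact hle hr'
  have hb : b₁ * b₀ ∉ νR.supp := fun h =>
    ((inferInstance : (AddValuation.toValuation νR).supp.IsPrime).mem_or_mem h).elim hb₁ hb₀
  have hφ : ∀ a, extendSupp νR (algebraMap R L a) = νR a := extendSupp_algebraMap
  have hb₀x : ∀ i, x i * algebraMap R L (b₁ * b₀) = algebraMap R L (a i * b₀) := fun i => by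
    rw [map_mul, map_mul, ha i, Algebra.smul_def]
    ring
  let D : BlowupData νR :=
    { b := b₁ * b₀
      b_notMem := hb
      r := n
      a := fun i => a i * b₀
      le := fun i => by
        rw [← hφ, ← hφ, ← hb₀x i, AddValuation.map_mul]
        exact le_add_of_nonneg_left (hX0 _ ⟨i, rfl⟩) }
  have hu : IsUnit (algebraMap R L D.b) := isUnit_map_of_notMem_supp hν hφ hb
  have hinj : Function.Injective
      (IsLocalization.Away.lift (S := Localization.Away D.b) D.b hu) := by
    rw [injective_iff_map_eq_zero]
    intro y hy
    obtain ⟨⟨r, s⟩, hys⟩ := IsLocalization.surj (Submonoid.powers D.b) y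
    have h1 := congrArg (IsLocalization.Away.lift (S := Localization.Away D.b) D.b hu) hys
    rw [map_mul, hy, zero_mul, IsLocalization.Away.lift_eq] at h1
    have h2 : algebraMap R (Localization.Away D.b) r = 0 :=
      (IsLocalization.map_eq_zero_iff (Submonoid.powers D.b) _ _).2
        ⟨⟨D.b, Submonoid.mem_powers _⟩, by
          change b₁ * b₀ * r = 0
          rw [mul_assoc, hker r h1.symm, mul_zero]⟩
    rw [h2] at hys
    exact ((IsLocalization.map_units (Localization.Away D.b) s).mul_left_eq_zero).1 hys
  obtain ⟨e⟩ := nonempty_localRing_equiv hν hφ D hu hνR.nonneg hinj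
  have hXeq : (fun i => IsLocalization.Away.lift (S := Localization.Away D.b) D.b hu
      (frac (D.a i) D.b)) = x := by
    funext i
    have h1 : frac (D.a i) D.b * algebraMap R _ D.b = algebraMap R _ (D.a i) :=
      IsLocalization.mk'_spec _ _ _
    have h2 := congrArg (IsLocalization.Away.lift (S := Localization.Away D.b) D.b hu) h1
    rw [map_mul, IsLocalization.Away.lift_eq, IsLocalization.Away.lift_eq] at h2
    exact hu.mul_left_injective (h2.trans (hb₀x i).symm)
  rw [hXeq] at e
  have := (hB.blowup hν (Set.finite_range x) hX0).noetherian
  exact ⟨D, IsGood.of_ringEquiv e.symm hgood⟩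

end Ambient

end Uniformization

/-! ### Convex subgroups and coarsenings -/

section OrderedQuotient

/-- The quotient of an ordered abelian group by a convex subgroup is an ordered abelian group. -/
theorem exists_ordered_quotient {Γ : Type v} [AddCommGroup Γ] [LinearOrder Γ]
    [IsOrderedAddMonoid Γ] (Δ : AddSubgroup Γ) (hΔ : (Δ : Set Γ).OrdConnected) :
    ∃ (Γ' : Type v) (_ : AddCommGroup Γ') (_ : LinearOrder Γ') (_ : IsOrderedAddMonoid Γ')
      (π : Γ →+ Γ'), Monotone π ∧ ∀ γ, π γ = 0 ↔ γ ∈ Δ := by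
  classical
  let π : Γ →+ Γ ⧸ Δ := QuotientAddGroup.mk' Δ
  have hπ : ∀ γ, π γ = 0 ↔ γ ∈ Δ := fun γ => QuotientAddGroup.eq_zero_iff γ
  let K : AddGroupCone (Γ ⧸ Δ) :=
    { (AddSubmonoid.nonneg Γ).map π with
      -- Convexity enters here: `0 ≤ γ ≤ γ + δ` and `γ + δ ∈ Δ` put `γ` in `Δ`.
      eq_zero_of_mem_of_neg_mem' := by
        rintro _ ⟨γ, hγ, rfl⟩ ⟨δ, hδ, h⟩
        have hsum : γ + δ ∈ Δ := by rw [← hπ, map_add, h, add_neg_cancel]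
        have hγ0 : (0 : Γ) ≤ γ := hγ
        have hδ0 : (0 : Γ) ≤ δ := hδ
        exact (hπ γ).2 (hΔ.out Δ.zero_mem hsum ⟨hγ0, le_add_of_nonneg_right hδ0⟩) }
  have htot : HasMemOrNegMem K := ⟨fun q => by
    obtain ⟨γ, rfl⟩ := QuotientAddGroup.mk'_surjective Δ q
    rcases le_total 0 γ with h | h
    · exact Or.inl ⟨γ, h, rfl⟩
    · exact Or.inr ⟨-γ, neg_nonneg.2 h, map_neg π γ⟩⟩
  let o : LinearOrder (Γ ⧸ Δ) := LinearOrder.mkOfAddGroupCone K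
  have ho : IsOrderedAddMonoid (Γ ⧸ Δ) := IsOrderedAddMonoid.mkOfCone K
  refine ⟨Γ ⧸ Δ, inferInstance, o, ho, π, fun γ δ h => ?_, hπ⟩
  change π δ - π γ ∈ K
  exact ⟨δ - γ, sub_nonneg.2 h, map_sub π δ γ⟩

end OrderedQuotient

section Coarsening

variable {L : Type u} [CommRing L] {Γ Γ' : Type v} [AddCommGroup Γ] [LinearOrder Γ]
  [IsOrderedAddMonoid Γ] [AddCommGroup Γ'] [LinearOrder Γ'] [IsOrderedAddMonoid Γ']

/-- `μ` is a coarsening of `ν`, with the same support. -/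
structure IsCoarsening (μ : AddValuation L (WithTop Γ')) (ν : AddValuation L (WithTop Γ)) :
    Prop where
  mono : ∀ x y, ν x ≤ ν y → μ x ≤ μ y
  top : ∀ x, μ x = ⊤ → ν x = ⊤

variable {μ : AddValuation L (WithTop Γ')} {ν : AddValuation L (WithTop Γ)}

theorem IsCoarsening.lt (h : IsCoarsening μ ν) {x y : L} (hxy : μ x < μ y) : ν x < ν y :=
  not_le.1 fun hle => (h.mono y x hle).not_gt hxy

theorem IsCoarsening.eq_zero (h : IsCoarsening μ ν) {x : L} (hx : ν x = 0) : μ x = 0 := by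
  rw [← ν.map_one] at hx
  rw [← μ.map_one]
  exact le_antisymm (h.mono _ _ hx.le) (h.mono _ _ hx.ge)

theorem IsCoarsening.nonneg (h : IsCoarsening μ ν) {x : L} (hx : 0 ≤ ν x) : 0 ≤ μ x := by
  rw [← ν.map_one] at hx
  rw [← μ.map_one]
  exact h.mono _ _ hx

theorem IsCoarsening.pos (h : IsCoarsening μ ν) {x : L} (hx : 0 < μ x) : 0 < ν x := by
  rw [← μ.map_one] at hx
  rw [← ν.map_one]
  exact h.lt hx

theorem IsCoarsening.top_iff (h : IsCoarsening μ ν) {x : L} : μ x = ⊤ ↔ ν x = ⊤ := by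
  refine ⟨h.top x, fun hx => ?_⟩
  have := h.mono 0 x (by rw [hx]; exact le_top)
  rwa [μ.map_zero, top_le_iff] at this

theorem IsCoarsening.isAmbient (h : IsCoarsening μ ν) (hν : IsAmbient ν) : IsAmbient μ :=
  ⟨fun x hx => hν.isUnit x (h.top_iff.not.1 hx), fun x hx => hν.isNilpotent x (h.top x hx)⟩

theorem IsCoarsening.localize_le (h : IsCoarsening μ ν) (T : Subring L) :
    localize ν T ≤ localize μ T := by
  rintro x ⟨s, hs, hs0, hx⟩
  exact ⟨s, hs, h.eq_zero hs0, hx⟩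

theorem exists_isCoarsening (ν : AddValuation L (WithTop Γ)) (Δ : AddSubgroup Γ)
    (hΔ : (Δ : Set Γ).OrdConnected) :
    ∃ (Γ' : Type v) (_ : AddCommGroup Γ') (_ : LinearOrder Γ') (_ : IsOrderedAddMonoid Γ')
      (μ : AddValuation L (WithTop Γ')), IsCoarsening μ ν ∧
        ∀ x (γ : Γ), ν x = γ → (μ x = 0 ↔ γ ∈ Δ) := by
  obtain ⟨Γ', _, _, _, π, hmono, hker⟩ := exists_ordered_quotient Δ hΔ
  have hm : Monotone (WithTop.map π) := hmono.withTop_map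
  refine ⟨Γ', _, _, _, ν.map π.withTopMap rfl hm, ⟨fun x y h => hm h, fun x h => ?_⟩,
    fun x γ h => ?_⟩
  · exact WithTop.map_eq_top_iff.1 h
  · change WithTop.map π (ν x) = 0 ↔ _
    rw [h, WithTop.map_coe, ← hker]
    exact WithTop.coe_eq_zero

end Coarsening

/-! ### The residual valuation and the image of a model in a quotient of `C` -/

section Residual

variable {L : Type u} [CommRing L] {Γ Γ' : Type v} [AddCommGroup Γ] [LinearOrder Γ]
  [IsOrderedAddMonoid Γ] [AddCommGroup Γ'] [LinearOrder Γ'] [IsOrderedAddMonoid Γ']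
  {μ : AddValuation L (WithTop Γ')} {ν : AddValuation L (WithTop Γ)}

open Classical in
/-- The valuation induced by `ν` on the valuation ring of its coarsening `μ`, with support the
center of `μ`. -/
noncomputable def residualOn (h : IsCoarsening μ ν) (C : Subring L) (hC : ∀ x ∈ C, 0 ≤ μ x) :
    AddValuation C (WithTop Γ) :=
  AddValuation.of (fun c => if μ c = 0 then ν c else ⊤)
    (by
      rw [if_neg]
      rw [Subring.coe_zero, μ.map_zero]
      exact WithTop.top_ne_zero)
    (by simp)
    (fun x y => by
      by_cases hxy : μ ((x + y : C) : L) = 0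
      · rw [if_pos hxy]
        rw [Subring.coe_add] at hxy ⊢
        by_cases hx : μ (x : L) = 0
        · by_cases hy : μ (y : L) = 0
          · rw [if_pos hx, if_pos hy]
            exact ν.map_add _ _
          · rw [if_pos hx, if_neg hy, min_top_right]
            -- Replacing `ν y` by `⊤` is harmless: `μ y > μ x` already forces `ν y > ν x`, so the
            -- minimum is attained at `x`.
            have hy' : μ (x : L) < μ (y : L) := by
              rw [hx]
              exact lt_of_le_of_ne (hC y y.2) (Ne.symm hy)
            exact ν.map_le_add le_rfl (h.lt hy').le
        · by_cases hy : μ (y : L) = 0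
          · rw [if_neg hx, if_pos hy, min_top_left]
            have hx' : μ (y : L) < μ (x : L) := by
              rw [hy]
              exact lt_of_le_of_ne (hC x x.2) (Ne.symm hx)
            exact ν.map_le_add (h.lt hx').le le_rfl
          · exact absurd hxy (μ.map_lt_add (lt_of_le_of_ne (hC x x.2) (Ne.symm hx))
              (lt_of_le_of_ne (hC y y.2) (Ne.symm hy))).ne'
      · rw [if_neg hxy]
        exact le_top)
    (fun x y => by
      rw [Subring.coe_mul, μ.map_mul, ν.map_mul]
      by_cases hx : μ (x : L) = 0
      · by_cases hy : μ (y : L) = 0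
        · rw [if_pos hx, if_pos hy, if_pos (by rw [hx, hy, add_zero])]
        · rw [if_neg hy, if_neg (by rwa [hx, zero_add]), add_top]
      · have hx' := lt_of_le_of_ne (hC x x.2) (Ne.symm hx)
        rw [if_neg hx, if_neg (add_pos_of_pos_of_nonneg hx' (hC y y.2)).ne', top_add])

variable {C : Subring L} {hC : ∀ x ∈ C, 0 ≤ μ x} {h : IsCoarsening μ ν}

theorem residualOn_of_eq_zero {c : C} (hc : μ c = 0) : residualOn h C hC c = ν c := by
  classical exact if_pos hc

theorem residualOn_of_pos {c : C} (hc : 0 < μ c) : residualOn h C hC c = ⊤ := by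
  classical exact if_neg hc.ne'

theorem residualOn_eq_top_iff {c : C} : residualOn h C hC c = ⊤ ↔ 0 < μ c := by
  refine ⟨fun htop => lt_of_le_of_ne (hC c c.2) fun h0 => ?_, residualOn_of_pos⟩
  rw [residualOn_of_eq_zero h0.symm, ← h.top_iff, ← h0] at htop
  exact WithTop.zero_ne_top htop

theorem residualOn_eq_zero_iff {c : C} : residualOn h C hC c = 0 ↔ ν c = 0 := by
  constructor
  · intro h0
    rcases (hC c c.2).eq_or_lt with hc | hc
    · rwa [residualOn_of_eq_zero hc.symm] at h0
    · rw [residualOn_of_pos hc] at h0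
      exact absurd h0 WithTop.top_ne_zero
  · intro h0
    rw [residualOn_of_eq_zero (h.eq_zero h0), h0]

theorem residualOn_nonneg_iff {c : C} : 0 ≤ residualOn h C hC c ↔ 0 ≤ ν c := by
  rcases (hC c c.2).eq_or_lt with hc | hc
  · rw [residualOn_of_eq_zero hc.symm]
  · rw [residualOn_of_pos hc]
    exact ⟨fun _ => (h.pos hc).le, fun _ => le_top⟩

/-- The image of a subring `T` of `L` in a quotient of `C`. -/
def resImage {C : Subring L} (J : Ideal C) (T : Subring L) : Subring (C ⧸ J) :=
  (T.comap C.subtype).map (Ideal.Quotient.mk J)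

theorem resImage_mono {J : Ideal C} {T T' : Subring L} (hT : T ≤ T') :
    resImage J T ≤ resImage J T' := by
  rintro x ⟨c, hc, rfl⟩
  exact ⟨c, hT hc, rfl⟩

theorem resImage_adjoin {J : Ideal C} {B : Subring L} (hB : B ≤ C) (X : Set C) :
    resImage J (adjoin B (Subtype.val '' X)) =
      adjoin (resImage J B) (Ideal.Quotient.mk J '' X) := by
  refine le_antisymm ?_ (adjoin_le_iff.2 ⟨resImage_mono (le_adjoin _ _), ?_⟩)
  · rintro _ ⟨c, hc, rfl⟩
    have hle : adjoin B (Subtype.val '' X) ≤ ((adjoin (resImage J B)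
        (Ideal.Quotient.mk J '' X)).comap (Ideal.Quotient.mk J)).map C.subtype := by
      refine adjoin_le_iff.2 ⟨fun b hb => ⟨⟨b, hB hb⟩, ?_, rfl⟩, ?_⟩
      · exact le_adjoin _ _ ⟨⟨b, hB hb⟩, hb, rfl⟩
      · rintro _ ⟨x, hx, rfl⟩
        exact ⟨x, subset_adjoin _ _ ⟨x, hx, rfl⟩, rfl⟩
    obtain ⟨c', hc', hcc⟩ := hle hc
    rwa [← Subtype.ext hcc]
  · rintro _ ⟨x, hx, rfl⟩
    exact ⟨x, subset_adjoin _ _ ⟨x, hx, rfl⟩, rfl⟩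

variable {J : Ideal C} {hJ : J ≤ (residualOn h C hC).supp}

/-- The residual valuation on a quotient of `C`. -/
noncomputable abbrev residual (h : IsCoarsening μ ν) (hC : ∀ x ∈ C, 0 ≤ μ x)
    (hJ : J ≤ (residualOn h C hC).supp) : AddValuation (C ⧸ J) (WithTop Γ) :=
  (residualOn h C hC).onQuot hJ

theorem residual_mk (c : C) : residual h hC hJ (Ideal.Quotient.mk J c) = residualOn h C hC c := rfl

/-- The quotient `C ⧸ J` is the new ambient ring: elements of `μ`-value zero are units of `C`, and
the others are nilpotent modulo `J`. -/
theorem isAmbient_residual (hμ : IsAmbient μ) (hCm : IsModel μ C)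
    (hnil : ∀ c : C, 0 < μ c → ∃ n : ℕ, c ^ n ∈ J) : IsAmbient (residual h hC hJ) := by
  constructor
  · intro x hx
    obtain ⟨c, rfl⟩ := Ideal.Quotient.mk_surjective x
    rw [residual_mk, Ne, residualOn_eq_top_iff, not_lt] at hx
    exact ((hCm.isUnit_iff hμ).2 (le_antisymm hx (hC c c.2))).map _
  · intro x hx
    obtain ⟨c, rfl⟩ := Ideal.Quotient.mk_surjective x
    rw [residual_mk, residualOn_eq_top_iff] at hx
    obtain ⟨n, hn⟩ := hnil c hx
    exact ⟨n, by rw [← map_pow, Ideal.Quotient.eq_zero_iff_mem.2 hn]⟩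

theorem resImage_localize (hμ : IsAmbient μ) (hCm : IsModel μ C) {T : Subring L} (hT : T ≤ C) :
    resImage J (localize ν T) = localize (residual h hC hJ) (resImage J T) := by
  ext x
  constructor
  · rintro ⟨c, ⟨s, hs, hs0, hcs⟩, rfl⟩
    refine ⟨_, ⟨⟨s, hT hs⟩, hs, rfl⟩, ?_, ⟨c * ⟨s, hT hs⟩, hcs, map_mul _ _ _⟩⟩
    rw [residual_mk, residualOn_eq_zero_iff]
    exact hs0
  · rintro ⟨_, ⟨s, hs, rfl⟩, hs0, ⟨t, ht, hxt⟩⟩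
    rw [residual_mk, residualOn_eq_zero_iff] at hs0
    obtain ⟨y, hy⟩ := ((hCm.isUnit_iff hμ).2 (h.eq_zero hs0)).exists_right_inv
    refine ⟨t * y, ⟨s, hs, hs0, ?_⟩, ?_⟩
    · have : C.subtype (t * y) * (s : L) = t := by
        have h1 : t * y * s = t := by rw [mul_assoc, mul_comm y, hy, mul_one]
        exact congrArg Subtype.val h1
      rw [this]
      exact ht
    · rw [map_mul, hxt, mul_assoc, ← map_mul, hy, map_one, mul_one]

theorem resImage_blowup (hμ : IsAmbient μ) (hCm : IsModel μ C) {B : Subring L} (hB : B ≤ C)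
    (X : Set C) : resImage J (blowup ν B (Subtype.val '' X)) =
      blowup (residual h hC hJ) (resImage J B) (Ideal.Quotient.mk J '' X) := by
  have hle : adjoin B (Subtype.val '' X) ≤ C := by
    refine adjoin_le_iff.2 ⟨hB, ?_⟩
    rintro _ ⟨x, -, rfl⟩
    exact x.2
  rw [blowup, resImage_localize hμ hCm hle, resImage_adjoin hB, blowup]

theorem isModel_resImage (hμ : IsAmbient μ) (hCm : IsModel μ C) {B : Subring L}
    (hB : IsModel ν B) (hBC : localize μ B = C) :
    IsModel (residual h hC hJ) (resImage J B) := by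
  have hle : B ≤ C := hBC ▸ le_localize B
  have := hB.noetherian
  refine ⟨⟨?_, fun x => ?_⟩, ?_, ?_⟩
  · let f : B →+* resImage J B := ((Ideal.Quotient.mk J).comp (Subring.inclusion hle)).codRestrict _
      fun b => ⟨⟨b, hle b.2⟩, b.2, rfl⟩
    refine isNoetherianRing_of_surjective _ _ f ?_
    rintro ⟨_, ⟨c, hc, rfl⟩⟩
    exact ⟨⟨c, hc⟩, rfl⟩
  · obtain ⟨c, rfl⟩ := Ideal.Quotient.mk_surjective x
    obtain ⟨s, hs, hs0, hcs⟩ := hBC.ge c.2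
    refine ⟨_, ⟨⟨s, hle hs⟩, hs, rfl⟩, ?_, ⟨c * ⟨s, hle hs⟩, hcs, map_mul _ _ _⟩⟩
    exact ((hCm.isUnit_iff hμ).2 hs0).map _
  · rintro _ ⟨c, hc, rfl⟩
    rw [residual_mk, residualOn_nonneg_iff]
    exact hB.nonneg _ hc
  · rw [← resImage_localize hμ hCm hle, hB.localize_eq]

end Residual

/-! ### Lifting a uniformization of the residual valuation -/

section Lifting

theorem exists_forall_mul_mem {A : Type*} [CommRing A] {K J : Ideal A} (hK : K.FG)
    (S : Submonoid A) (h : ∀ g ∈ K, ∃ s ∈ S, s * g ∈ J) : ∃ s ∈ S, ∀ g ∈ K, s * g ∈ J := by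
  classical
  obtain ⟨G, rfl⟩ := hK
  choose! s hs hsg using fun g (hg : g ∈ (G : Set A)) => h g (Ideal.subset_span hg)
  refine ⟨∏ g ∈ G, s g, prod_mem fun g hg => hs g hg, fun g hg => ?_⟩
  have hle : Ideal.span (G : Set A) ≤ Submodule.comap (LinearMap.mulLeft A (∏ g ∈ G, s g)) J := by
    refine Ideal.span_le.2 fun g hg => ?_
    obtain ⟨c, hc⟩ := Finset.dvd_prod_of_mem s hg
    change (∏ g ∈ G, s g) * g ∈ J
    rw [hc, mul_right_comm]
    exact Ideal.mul_mem_right _ _ (hsg g hg)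
  exact hle hg

theorem isGood_of_localization_of_quotient_span {B : Type u} [CommRing B] {P : Ideal B}
    [P.IsPrime] {C : Type*} [CommRing C] [Algebra B C] [IsLocalization.AtPrime C P]
    [IsLocalRing B] [IsNoetherianRing B] {t : ℕ} {y : Fin t → B} (hI : (nilradical B).IsPrime)
    (hP : P = Ideal.span (Set.range y) ⊔ nilradical B) (hC : IsGood C)
    (hdim : ringKrullDim C = t) (hS : IsGood (B ⧸ Ideal.span (Set.range y))) : IsGood B := by
  have h : Ideal.span (Set.range y) = Ideal.ofList (List.ofFn y) :=
    congrArg Ideal.span (Set.ext fun a => by simp)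
  rw [h] at hP hS
  exact isGood_of_localization_of_quotient (P := P) (C := C) hI hP hC (by simpa using hdim) hS

variable {L : Type u} [CommRing L] {Γ Γ' : Type v} [AddCommGroup Γ] [LinearOrder Γ]
  [IsOrderedAddMonoid Γ] [AddCommGroup Γ'] [LinearOrder Γ'] [IsOrderedAddMonoid Γ']
  {μ : AddValuation L (WithTop Γ')} {ν : AddValuation L (WithTop Γ)}

/-- A regular system of parameters of the reduction of `C = localize μ B`, lifted to `B`. -/
theorem exists_parameters (hμ : IsAmbient μ) {B C : Subring L} (hBC : localize μ B = C)
    (hCm : IsModel μ C) [IsLocalRing C] (hgood : IsGood C) :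
    ∃ (t : ℕ) (y : Fin t → C), (∀ i, (y i : L) ∈ B) ∧
      Ideal.span (Set.range y) ⊔ nilradical C = maximalIdeal C ∧ ringKrullDim C = t := by
  have := hgood.1
  obtain ⟨xs, hxs, hlen⟩ := exists_list_sup_ker_eq_maximalIdeal
    (Ideal.Quotient.mk (nilradical C)) Ideal.Quotient.mk_surjective
  rw [Ideal.mk_ker] at hxs hlen
  rw [ringKrullDim_quotient_nilradical] at hlen
  have hs : ∀ c : C, ∃ u : C, IsUnit u ∧ ((c * u : C) : L) ∈ B := fun c => by
    obtain ⟨s, hs, hs0, hcs⟩ := hBC.ge c.2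
    exact ⟨⟨s, hBC ▸ le_localize B hs⟩, (hCm.isUnit_iff hμ).2 hs0, hcs⟩
  choose u hu huB using hs
  refine ⟨xs.length, fun i => xs.get i * u (xs.get i), fun i => huB _, ?_, hlen.symm⟩
  rw [← hxs]
  congr 1
  refine le_antisymm (Ideal.span_le.2 ?_) (Ideal.span_le.2 fun x hx => ?_)
  · rintro _ ⟨i, rfl⟩
    exact Ideal.mul_mem_right _ _ (Ideal.subset_span (xs.get_mem i))
  · obtain ⟨i, rfl⟩ := List.get_of_mem hx
    rw [SetLike.mem_coe, ← Ideal.mul_unit_mem_iff_mem _ (hu (xs.get i))]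
    exact Ideal.subset_span ⟨i, rfl⟩

theorem exists_adjoin_sub_mem {B B₂ : Subring L} {W : Set L} (hBB₂ : B ≤ B₂) (hW : W ⊆ B₂)
    {I : Ideal B₂} (hWI : ∀ w : B₂, (w : L) ∈ W → w ∈ I) (a : B₂) (ha : (a : L) ∈ adjoin B W) :
    ∃ b : B, a - Subring.inclusion hBB₂ b ∈ I := by
  have hle : adjoin B W ≤ ((((Ideal.Quotient.mk I).comp (Subring.inclusion hBB₂)).range).comap
      (Ideal.Quotient.mk I)).map B₂.subtype := by
    refine adjoin_le_iff.2 ⟨fun b hb => ⟨⟨b, hBB₂ hb⟩, ⟨⟨b, hb⟩, rfl⟩, rfl⟩, fun w hw => ?_⟩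
    refine ⟨⟨w, hW hw⟩, ⟨0, ?_⟩, rfl⟩
    rw [map_zero]
    exact (Ideal.Quotient.eq_zero_iff_mem.2 (hWI ⟨w, hW hw⟩ hw)).symm
  obtain ⟨a', ⟨b, hb⟩, haa⟩ := hle ha
  rw [Subtype.ext haa] at hb
  exact ⟨b, Ideal.Quotient.eq.1 hb.symm⟩

theorem localize_eq_of_le {B B₂ C : Subring L}
    (hBC : localize μ B = C) (h1 : B ≤ B₂) (h2 : B₂ ≤ C) : localize μ B₂ = C := by
  refine le_antisymm ?_ (hBC ▸ localize_mono h1)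
  rw [← hBC, ← localize_localize B, hBC]
  exact localize_mono h2

theorem blowup_le (hcoarse : IsCoarsening μ ν) {B C : Subring L} {X : Set L}
    (hBC : localize μ B = C) (hX : X ⊆ C) : blowup ν B X ≤ C := by
  have hle : B ≤ C := hBC ▸ le_localize B
  refine (hcoarse.localize_le _).trans ?_
  rw [← hBC, localize_le_iff (localize_localize B), hBC]
  exact adjoin_le_iff.2 ⟨hle, hX⟩

theorem adjoin_eq_self {B : Subring L} {X : Set L} (h : X ⊆ B) : adjoin B X = B :=
  le_antisymm (adjoin_le_iff.2 ⟨le_rfl, h⟩) (le_adjoin _ _)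

theorem le_blowup (B : Subring L) (X : Set L) : B ≤ blowup ν B X :=
  (le_adjoin B X).trans (le_localize _)

theorem subset_blowup (B : Subring L) (X : Set L) : X ⊆ blowup ν B X :=
  (subset_adjoin B X).trans (le_localize _)

/-- In `B` the `y` generate `J ∩ B`, and with the nilradical the center of `μ`, only up to a factor
`s` of `μ`-value zero. Adjoining the quotients `y i / s` removes this factor, without changing `C`
or the image in `C ⧸ J`; then the descent criterion applies. -/
theorem hasUniformization_of_isGood_resImage (hν : IsAmbient ν) (hcoarse : IsCoarsening μ ν)
    {B C : Subring L} (hB : IsModel ν B) (hBC : localize μ B = C) (hCm : IsModel μ C)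
    [IsLocalRing C] (hgood : IsGood C) {t : ℕ} {y : Fin t → C} (hyB : ∀ i, (y i : L) ∈ B)
    (hy : Ideal.span (Set.range y) ⊔ nilradical C = maximalIdeal C) (hdim : ringKrullDim C = t)
    (hJ : Ideal.span (Set.range y) ≤ (residualOn hcoarse C hCm.nonneg).supp)
    (hres : IsGood (resImage (Ideal.span (Set.range y)) B)) : HasUniformization ν B := by
  have hμ := hcoarse.isAmbient hν
  have hle : B ≤ C := hBC ▸ le_localize B
  have := hB.noetherian
  have hμB : ∀ x ∈ B, 0 ≤ μ x := fun x hx => hCm.nonneg x (hle hx)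
  set J := Ideal.span (Set.range y) with hJdef
  -- Both inclusions hold in `C`; the ideals are finitely generated, so one denominator serves all
  -- their elements.
  obtain ⟨s, hs0, hK, hP⟩ : ∃ s : B, μ (s : L) = 0 ∧
      (∀ b : B, Subring.inclusion hle b ∈ J →
        s * b ∈ Ideal.span (Set.range fun i => (⟨y i, hyB i⟩ : B))) ∧
      (∀ b : B, 0 < μ (b : L) →
        s * b ∈ Ideal.span (Set.range fun i => (⟨y i, hyB i⟩ : B)) ⊔ nilradical B) := by
    obtain ⟨P, hPp, hPmem, hloc⟩ := exists_isLocalization_localize hμ hμB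
    subst hBC
    let := (Subring.inclusion (le_localize (ν := μ) B)).toAlgebra
    have hmapJ : (Ideal.span (Set.range fun i => (⟨y i, hyB i⟩ : B))).map
        (algebraMap B (localize μ B)) = J := by
      rw [Ideal.map_span, ← Set.range_comp]
      rfl
    have hmapP : (Ideal.span (Set.range fun i => (⟨y i, hyB i⟩ : B)) ⊔ nilradical B).map
        (algebraMap B (localize μ B)) = maximalIdeal (localize μ B) := by
      rw [Ideal.map_sup, hmapJ, map_nilradical_of_isLocalization P.primeCompl, hy]
    obtain ⟨s₁, hs₁, h₁⟩ := exists_forall_mul_mem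
      (K := J.comap (algebraMap B (localize μ B)))
      (J := Ideal.span (Set.range fun i => (⟨y i, hyB i⟩ : B)))
      (IsNoetherian.noetherian _) P.primeCompl fun g hg => by
        rw [Ideal.mem_comap, ← hmapJ,
          IsLocalization.algebraMap_mem_map_algebraMap_iff P.primeCompl] at hg
        exact hg
    obtain ⟨s₂, hs₂, h₂⟩ := exists_forall_mul_mem
      (K := (maximalIdeal (localize μ B)).comap (algebraMap B (localize μ B)))
      (J := Ideal.span (Set.range fun i => (⟨y i, hyB i⟩ : B)) ⊔ nilradical B)
      (IsNoetherian.noetherian _) P.primeCompl fun g hg => by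
        rw [Ideal.mem_comap, ← hmapP,
          IsLocalization.algebraMap_mem_map_algebraMap_iff P.primeCompl] at hg
        exact hg
    refine ⟨s₁ * s₂, ?_, fun b hb => ?_, fun b hb => ?_⟩
    · have h12 : ¬ 0 < μ ((s₁ * s₂ : B) : L) := fun h =>
        (P.primeCompl.mul_mem hs₁ hs₂) ((hPmem _).2 h)
      exact le_antisymm (not_lt.1 h12) (hμB _ (s₁ * s₂).2)
    · rw [mul_right_comm]
      exact Ideal.mul_mem_right _ _ (h₁ b hb)
    · rw [mul_assoc]
      exact Ideal.mul_mem_left _ _ (h₂ b ((hCm.mem_maximalIdeal_iff hμ).2 hb))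
  have hsu : IsUnit (s : L) := hμ.isUnit _ (by rw [hs0]; exact WithTop.zero_ne_top)
  obtain ⟨u, hu⟩ := hsu.exists_right_inv
  have hu0 := eq_zero_of_mul_eq_one hu hs0
  have hypos : ∀ i, 0 < μ (y i : L) := fun i => by
    rw [← hCm.mem_maximalIdeal_iff hμ, ← hy]
    exact Ideal.mem_sup_left (Ideal.subset_span ⟨i, rfl⟩)
  have huC : u ∈ C := by
    rw [← hBC]
    exact ⟨s, s.2, hs0, by rw [mul_comm, hu]; exact B.one_mem⟩
  -- Dividing by `s` is allowed even if `ν s > 0`: the `μ`-value of `w i` is positive, and this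
  -- forces a positive `ν`-value.
  let w : Fin t → L := fun i => y i * u
  have hwpos : ∀ i, 0 < μ (w i) := fun i => by
    rw [val_eq_zero_of_mul hu0]
    exact hypos i
  have hWC : Set.range w ⊆ C := by
    rintro _ ⟨i, rfl⟩
    exact C.mul_mem (y i).2 huC
  have hW0 : ∀ x ∈ Set.range w, 0 ≤ ν x := by
    rintro _ ⟨i, rfl⟩
    exact (hcoarse.pos (hwpos i)).le
  refine ⟨Set.range w, Set.finite_range w, hW0, ?_⟩
  have hB₂ := hB.blowup hν (Set.finite_range w) hW0
  have hBB₂ : B ≤ blowup ν B (Set.range w) := le_blowup B _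
  have hWB₂ : Set.range w ⊆ blowup ν B (Set.range w) := subset_blowup B _
  have hB₂C : blowup ν B (Set.range w) ≤ C := blowup_le hcoarse hBC hWC
  have hresB₂ : resImage J (blowup ν B (Set.range w)) = resImage J B := by
    have himg : Set.range w = Subtype.val '' {c : C | (c : L) ∈ Set.range w} := by
      ext x
      exact ⟨fun hx => ⟨⟨x, hWC hx⟩, hx, rfl⟩, by rintro ⟨c, hc, rfl⟩; exact hc⟩
    have hm := isModel_resImage (hJ := hJ) hμ hCm hB hBC
    rw [himg, resImage_blowup (hJ := hJ) hμ hCm hle, blowup, adjoin_eq_self, hm.localize_eq]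
    rintro _ ⟨c, ⟨i, hi⟩, rfl⟩
    have : c = y i * ⟨u, huC⟩ := Subtype.ext hi.symm
    rw [this, map_mul, Ideal.Quotient.eq_zero_iff_mem.2
      (show y i ∈ J from Ideal.subset_span ⟨i, rfl⟩), zero_mul]
    exact Subring.zero_mem _
  have hCB₂ : localize μ (blowup ν B (Set.range w)) = C := localize_eq_of_le hBC hBB₂ hB₂C
  generalize hB₂def : blowup ν B (Set.range w) = B₂ at *
  have := hB₂.noetherian
  have := hB₂.isLocalRing hν
  have hμB₂ : ∀ x ∈ B₂, 0 ≤ μ x := fun x hx => hCm.nonneg x (hB₂C hx)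
  let ι := Subring.inclusion hBB₂
  let wB : Fin t → B₂ := fun i => ⟨w i, hWB₂ ⟨i, rfl⟩⟩
  let I := Ideal.span (Set.range wB)
  have hsmul : ∀ j ∈ Ideal.span (Set.range fun i => (⟨y i, hyB i⟩ : B)),
      ∃ q ∈ I, ι s * q = ι j := fun j hj => by
    rw [← Ideal.mem_span_singleton_mul]
    have hle' : Ideal.span (Set.range fun i => (⟨y i, hyB i⟩ : B)) ≤
        (Ideal.span {ι s} * I).comap ι := by
      refine Ideal.span_le.2 ?_
      rintro _ ⟨i, rfl⟩
      refine Ideal.mem_span_singleton_mul.2 ⟨wB i, Ideal.subset_span ⟨i, rfl⟩, Subtype.ext ?_⟩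
      change (s : L) * (y i * u) = y i
      rw [mul_left_comm, hu, mul_one]
    exact hle' hj
  have hIJ : ∀ b : B, Subring.inclusion hle b ∈ J → ι b ∈ I := fun b hb => by
    obtain ⟨q, hq, hqb⟩ := hsmul _ (hK b hb)
    rw [map_mul] at hqb
    have hbq : q = ι b := Subtype.ext (hsu.mul_right_injective (congrArg Subtype.val hqb))
    rwa [← hbq]
  have hIP : ∀ b : B, 0 < μ (b : L) → ι b ∈ I ⊔ nilradical B₂ := fun b hb => by
    obtain ⟨j, hj, z, hz, hjz⟩ := Submodule.mem_sup.1 (hP b hb)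
    obtain ⟨q, hq, hqj⟩ := hsmul j hj
    have hnil : ι b - q ∈ nilradical B₂ := by
      have h1 : ι s * (ι b - q) = ι z := by
        rw [mul_sub, hqj, ← map_mul, ← hjz, map_add, add_sub_cancel_left]
      rw [hν.mem_nilradical_iff] at hz ⊢
      have h2 := congrArg (fun x : B₂ => μ (x : L)) h1
      simp only [Subring.coe_mul, μ.map_mul] at h2
      rw [show μ ((ι s : B₂) : L) = 0 from hs0, zero_add] at h2
      rw [← hcoarse.top_iff] at hz ⊢
      rw [h2]
      exact hz
    rw [← sub_add_cancel (ι b) q, add_comm]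
    exact Submodule.add_mem_sup hq hnil
  -- Up to a unit, an element of `B₂` lies in `B[w]`, hence is congruent to an element of `B` modulo
  -- `I = (w)`. This reduces the computation of `P` and of the kernel of `B₂ → C ⧸ J` to elements of
  -- `B`, that is, to `hIP` and `hIJ`.
  have hG : ∀ x : B₂, ∃ τ : B₂, IsUnit τ ∧ ∃ b : B, x * τ - ι b ∈ I := fun x => by
    obtain ⟨τ, hτ, hτ0, hx⟩ := hB₂def.ge x.2
    have hτB₂ : τ ∈ B₂ := hB₂def.le (le_localize _ hτ)
    refine ⟨⟨τ, hτB₂⟩, (hB₂.isUnit_iff hν).2 hτ0, ?_⟩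
    refine exists_adjoin_sub_mem hBB₂ hWB₂ ?_ (x * ⟨τ, hτB₂⟩) hx
    rintro w' ⟨i, hi⟩
    exact Ideal.subset_span ⟨i, Subtype.ext hi⟩
  obtain ⟨P, hPp, hPmem, hloc⟩ := exists_isLocalization_localize hμ hμB₂
  let := (Subring.inclusion (le_localize (ν := μ) B₂)).toAlgebra
  have hPI : P = I ⊔ nilradical B₂ := by
    have hIP' : I ≤ P := by
      refine Ideal.span_le.2 ?_
      rintro _ ⟨i, rfl⟩
      exact (hPmem _).2 (hwpos i)
    refine le_antisymm (fun x hx => ?_) (sup_le hIP' (nilradical_le_prime P))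
    obtain ⟨τ, hτ, b, hb⟩ := hG x
    have hbP : ι b ∈ P := by
      simpa only [sub_sub_cancel] using Ideal.sub_mem P (Ideal.mul_mem_right τ _ hx) (hIP' hb)
    rw [← Ideal.mul_unit_mem_iff_mem _ hτ, ← sub_add_cancel (x * τ) (ι b)]
    exact Ideal.add_mem _ (Ideal.mem_sup_left hb) (hIP b ((hPmem _).1 hbP))
  let f : B₂ →+* resImage J B₂ := ((Ideal.Quotient.mk J).comp
    (Subring.inclusion hB₂C)).codRestrict _ fun b => ⟨⟨b, hB₂C b.2⟩, b.2, rfl⟩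
  have hf : Function.Surjective f := by
    rintro ⟨_, ⟨c, hc, rfl⟩⟩
    exact ⟨⟨c, hc⟩, rfl⟩
  have hfJ : ∀ x, f x = 0 ↔ Subring.inclusion hB₂C x ∈ J := fun x => by
    rw [← Ideal.Quotient.eq_zero_iff_mem]
    exact Subtype.ext_iff
  have hker : RingHom.ker f = I := by
    have hIf : I ≤ RingHom.ker f := by
      refine Ideal.span_le.2 ?_
      rintro _ ⟨i, rfl⟩
      refine (hfJ _).2 ?_
      have : Subring.inclusion hB₂C (wB i) = y i * ⟨u, huC⟩ := rfl
      rw [this]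
      exact Ideal.mul_mem_right _ _ (Ideal.subset_span ⟨i, rfl⟩)
    refine le_antisymm (fun x hx => ?_) hIf
    obtain ⟨τ, hτ, b, hb⟩ := hG x
    have hb' : ι b ∈ RingHom.ker f := by
      simpa only [sub_sub_cancel] using Ideal.sub_mem _ (Ideal.mul_mem_right τ _ hx) (hIf hb)
    rw [← Ideal.mul_unit_mem_iff_mem _ hτ, ← sub_add_cancel (x * τ) (ι b)]
    exact Ideal.add_mem _ hb (hIJ b ((hfJ _).1 hb'))
  rw [← hresB₂] at hres
  have hquot : IsGood (B₂ ⧸ I) := by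
    have e : B₂ ⧸ I ≃+* resImage J B₂ :=
      (Ideal.quotEquivOfEq hker.symm).trans (RingHom.quotientKerEquivOfSurjective hf)
    have : IsNoetherianRing (resImage J B₂) := isNoetherianRing_of_surjective _ _ f hf
    exact hres.of_ringEquiv e.symm
  rw [← hCB₂] at hdim hgood
  exact isGood_of_localization_of_quotient_span (P := P) (C := localize μ B₂)
    hν.isPrime_nilradical hPI hgood hdim hquot

theorem HasUniformization.of_residual (hν : IsAmbient ν) (hcoarse : IsCoarsening μ ν)
    {B C : Subring L} (hB : IsModel ν B) (hBC : localize μ B = C) (hCm : IsModel μ C)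
    [IsLocalRing C] (hgood : IsGood C) {t : ℕ} {y : Fin t → C} (hyB : ∀ i, (y i : L) ∈ B)
    (hy : Ideal.span (Set.range y) ⊔ nilradical C = maximalIdeal C) (hdim : ringKrullDim C = t)
    (hJ : Ideal.span (Set.range y) ≤ (residualOn hcoarse C hCm.nonneg).supp)
    (h : HasUniformization (residual hcoarse hCm.nonneg hJ)
      (resImage (Ideal.span (Set.range y)) B)) : HasUniformization ν B := by
  have hμ := hcoarse.isAmbient hν
  have hle : B ≤ C := hBC ▸ le_localize B
  obtain ⟨Xq, hXq, hXq0, hgoodq⟩ := h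
  obtain ⟨g, hg⟩ := (Ideal.Quotient.mk_surjective
    (I := Ideal.span (Set.range y))).hasRightInverse
  have himg : Ideal.Quotient.mk (Ideal.span (Set.range y)) '' (g '' Xq) = Xq := by
    rw [Set.image_image]
    simp only [hg _, Set.image_id']
  have hfin : (Subtype.val '' (g '' Xq) : Set L).Finite := (hXq.image _).image _
  have hX0 : ∀ x ∈ (Subtype.val '' (g '' Xq) : Set L), 0 ≤ ν x := by
    rintro _ ⟨_, ⟨x, hx, rfl⟩, rfl⟩
    have := hXq0 x hx
    rwa [← hg x, residual_mk, residualOn_nonneg_iff] at this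
  have hXC : (Subtype.val '' (g '' Xq) : Set L) ⊆ C := by
    rintro _ ⟨c, -, rfl⟩
    exact c.2
  have hres := resImage_blowup (hJ := hJ) hμ hCm hle (g '' Xq)
  rw [himg] at hres
  rw [← hres] at hgoodq
  exact (hasUniformization_of_isGood_resImage hν hcoarse (hB.blowup hν hfin hX0)
    (localize_eq_of_le hBC (le_blowup _ _) (blowup_le hcoarse hBC hXC)) hCm hgood
    (fun i => le_blowup _ _ (hyB i)) hy hdim hJ hgoodq).of_blowup hfin hX0

end Lifting

/-! ### The induction on the dimension -/

section Induction

variable {L : Type u} [CommRing L] {Γ Γ' : Type v} [AddCommGroup Γ] [LinearOrder Γ]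
  [IsOrderedAddMonoid Γ] [AddCommGroup Γ'] [LinearOrder Γ'] [IsOrderedAddMonoid Γ']
  {μ : AddValuation L (WithTop Γ')} {ν : AddValuation L (WithTop Γ)}

theorem HasUniformization.of_forall_eq_zero_or_eq_top (hν : IsAmbient ν) {B : Subring L}
    (hB : IsModel ν B) (h : ∀ b ∈ B, ν b = 0 ∨ ν b = ⊤) : HasUniformization ν B := by
  refine ⟨∅, Set.finite_empty, fun x hx => hx.elim, ?_⟩
  rw [LocalUniformization.blowup, adjoin_eq_self (Set.empty_subset _), hB.localize_eq]
  have := hB.isLocalRing hν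
  have hnil : nilradical B = maximalIdeal B := by
    ext b
    rw [hν.mem_nilradical_iff, hB.mem_maximalIdeal_iff hν]
    refine ⟨fun hb => by rw [hb]; exact WithTop.coe_lt_top 0, fun hb => ?_⟩
    exact (h b b.2).resolve_left hb.ne'
  have hmax : (nilradical B).IsMaximal := hnil ▸ inferInstance
  let := Ideal.Quotient.field (nilradical B)
  exact ⟨inferInstance, fun n => Module.Free.of_divisionRing _ _⟩

/-- The smallest convex subgroup of `Γ` containing `H`. -/
def convexClosure (H : AddSubgroup Γ) : AddSubgroup Γ where
  carrier := {γ | ∃ h ∈ H, |γ| ≤ h}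
  zero_mem' := ⟨0, H.zero_mem, by simp⟩
  add_mem' := by
    rintro γ δ ⟨h, hh, hγ⟩ ⟨k, hk, hδ⟩
    exact ⟨h + k, H.add_mem hh hk, (abs_add_le γ δ).trans (add_le_add hγ hδ)⟩
  neg_mem' := by
    rintro γ ⟨h, hh, hγ⟩
    exact ⟨h, hh, by rwa [abs_neg]⟩

theorem ordConnected_convexClosure (H : AddSubgroup Γ) :
    (convexClosure H : Set Γ).OrdConnected := by
  refine ⟨fun γ hγ δ hδ ε hε => ?_⟩
  obtain ⟨h, hh, hγ⟩ := hγ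
  obtain ⟨k, hk, hδ⟩ := hδ
  have h0 : 0 ≤ h := (abs_nonneg γ).trans hγ
  have k0 : 0 ≤ k := (abs_nonneg δ).trans hδ
  refine ⟨h + k, H.add_mem hh hk, abs_le.2 ⟨?_, ?_⟩⟩
  · refine le_trans ?_ ((neg_le_of_abs_le hγ).trans hε.1)
    exact neg_le_neg (le_add_of_nonneg_right k0)
  · exact (hε.2.trans (le_of_abs_le hδ)).trans (le_add_of_nonneg_left h0)

/-- Elements of `L` of finite value are units, so the finite values on `L` already form a group. -/
theorem exists_eq_of_mem_valueGroup (hν : IsAmbient ν) {B : Subring L} {γ : Γ}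
    (hγ : γ ∈ valueGroup (ν.comap B.subtype)) : ∃ x : L, ν x = γ := by
  induction hγ using AddSubgroup.closure_induction with
  | mem γ h =>
    obtain ⟨b, hb⟩ := h
    exact ⟨b, hb⟩
  | zero => exact ⟨1, ν.map_one⟩
  | add γ δ _ _ h k =>
    obtain ⟨x, hx⟩ := h
    obtain ⟨y, hy⟩ := k
    exact ⟨x * y, by rw [ν.map_mul, hx, hy, WithTop.coe_add]⟩
  | neg γ _ h =>
    obtain ⟨x, hx⟩ := h
    obtain ⟨y, hy⟩ := (hν.isUnit x (by rw [hx]; exact WithTop.coe_ne_top)).exists_right_inv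
    have h1 := congrArg ν hy
    rw [ν.map_mul, hx, ν.map_one] at h1
    obtain ⟨δ, hδ⟩ := WithTop.ne_top_iff_exists.1 (show ν y ≠ ⊤ from fun h => by
      rw [h, add_top] at h1
      exact WithTop.top_ne_zero h1)
    refine ⟨y, ?_⟩
    rw [← hδ] at h1 ⊢
    rw [← WithTop.coe_add, WithTop.coe_eq_zero] at h1
    rw [eq_neg_of_add_eq_zero_right h1]

theorem exists_isCoarsening_of_rank_ne_one (hν : IsAmbient ν) {B : Subring L}
    (hB : IsModel ν B) (hne : ∃ b ∈ B, ν b ≠ 0 ∧ ν b ≠ ⊤)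
    (hrank : rank (ν.comap B.subtype) ≠ 1) :
    ∃ (Γ' : Type v) (_ : AddCommGroup Γ') (_ : LinearOrder Γ') (_ : IsOrderedAddMonoid Γ')
      (μ : AddValuation L (WithTop Γ')), IsCoarsening μ ν ∧ (∃ x, 0 < ν x ∧ μ x = 0) ∧
        ∃ x ∈ B, 0 < μ x ∧ ν x ≠ ⊤ := by
  -- The value group is nonzero, so `⊥` is a proper convex subgroup; if it were the only one, the
  -- rank would be one.
  obtain ⟨H, hHtop, hHconn, hHbot⟩ : ∃ H : AddSubgroup (valueGroup (ν.comap B.subtype)),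
      H ≠ ⊤ ∧ (H : Set (valueGroup (ν.comap B.subtype))).OrdConnected ∧ H ≠ ⊥ := by
    by_contra! hcon
    refine hrank (Set.encard_eq_one.2 ⟨⊥, Set.eq_singleton_iff_unique_mem.2
      ⟨⟨fun hbot => ?_, ?_⟩, fun H hH => hcon H hH.1 hH.2⟩⟩)
    · obtain ⟨b, hb, hb0, hbt⟩ := hne
      obtain ⟨γ, hγ⟩ := WithTop.ne_top_iff_exists.1 hbt
      have hmem : γ ∈ valueGroup (ν.comap B.subtype) :=
        AddSubgroup.subset_closure ⟨⟨b, hb⟩, hγ.symm⟩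
      have h0 : (⟨γ, hmem⟩ : valueGroup (ν.comap B.subtype)) ∈
          (⊥ : AddSubgroup (valueGroup (ν.comap B.subtype))) := hbot ▸ AddSubgroup.mem_top _
      rw [AddSubgroup.mem_bot, Subtype.ext_iff] at h0
      exact hb0 (by rw [← hγ]; exact WithTop.coe_eq_zero.2 h0)
    · rw [AddSubgroup.coe_bot]
      exact Set.ordConnected_singleton
  obtain ⟨h, hh, hpos⟩ : ∃ h ∈ H, 0 < h := by
    obtain ⟨h, hh, h0⟩ := H.bot_or_exists_ne_zero.resolve_left hHbot
    rcases lt_or_gt_of_ne h0 with hlt | hgt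
    · exact ⟨-h, H.neg_mem hh, neg_pos.2 hlt⟩
    · exact ⟨h, hh, hgt⟩
  obtain ⟨b, γ, hγ, hγH⟩ : ∃ (b : B) (γ : Γ), ν b = γ ∧
      ∀ hmem : γ ∈ valueGroup (ν.comap B.subtype), (⟨γ, hmem⟩ : valueGroup _) ∉ H := by
    by_contra! hcon
    refine hHtop (eq_top_iff.2 fun g _ => ?_)
    have hle : valueGroup (ν.comap B.subtype) ≤ H.map (valueGroup _).subtype := by
      refine (AddSubgroup.closure_le _).2 ?_
      rintro γ ⟨b, hb⟩
      obtain ⟨hmem, hH⟩ := hcon b γ hb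
      exact ⟨_, hH, rfl⟩
    obtain ⟨g', hg', hgg⟩ := hle g.2
    rwa [← Subtype.ext hgg]
  -- `H` is convex only within the value group, so its convex closure in `Γ` is divided out; it
  -- still misses `γ`, by convexity of `H`.
  obtain ⟨Γ', _, _, _, μ, hcoarse, hμ⟩ := exists_isCoarsening ν
    (convexClosure (H.map (valueGroup (ν.comap B.subtype)).subtype))
    (ordConnected_convexClosure _)
  refine ⟨Γ', _, _, _, μ, hcoarse, ?_, b, b.2, ?_, by rw [hγ]; exact WithTop.coe_ne_top⟩
  · obtain ⟨x, hx⟩ := exists_eq_of_mem_valueGroup hν h.2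
    refine ⟨x, ?_, (hμ x h hx).2 ⟨h, ⟨h, hh, rfl⟩, (abs_of_pos hpos).le⟩⟩
    rw [hx]
    exact WithTop.coe_pos.2 hpos
  · refine lt_of_le_of_ne (hcoarse.nonneg (hB.nonneg b b.2)) fun h0 => ?_
    obtain ⟨_, ⟨k, hk, rfl⟩, hle⟩ := (hμ b γ hγ).1 h0.symm
    have hmem : γ ∈ valueGroup (ν.comap B.subtype) := AddSubgroup.subset_closure ⟨b, hγ⟩
    exact hγH hmem (hHconn.out (H.neg_mem hk) hk
      ⟨neg_le_of_abs_le hle, le_of_abs_le hle⟩)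

theorem ringKrullDim_localize_add_one_le (hν : IsAmbient ν) (hcoarse : IsCoarsening μ ν)
    {B : Subring L} (hB : IsModel ν B) {x : L} (hxB : x ∈ B) (hx : 0 < ν x) (hx0 : μ x = 0) :
    ringKrullDim (localize μ B) + 1 ≤ ringKrullDim B := by
  have := hB.isLocalRing hν
  have := hB.noetherian
  obtain ⟨P, hP, hPmem, hloc⟩ := exists_isLocalization_localize (hcoarse.isAmbient hν)
    fun x hx => hcoarse.nonneg (hB.nonneg x hx)
  let := (Subring.inclusion (le_localize (ν := μ) B)).toAlgebra
  rw [IsLocalization.AtPrime.ringKrullDim_eq_height P, ← maximalIdeal_height_eq_ringKrullDim]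
  have hlt : P < maximalIdeal B := by
    refine lt_of_le_of_ne (le_maximalIdeal hP.ne_top) fun h => ?_
    have hxm : (⟨x, hxB⟩ : B) ∈ maximalIdeal B := (hB.mem_maximalIdeal_iff hν).2 hx
    rw [← h, hPmem] at hxm
    exact hxm.ne' hx0
  exact_mod_cast Ideal.height_add_one_le_of_lt_of_isPrime hlt

theorem localize_localize_of_coarsening (hcoarse : IsCoarsening μ ν) (T : Subring L) :
    localize μ (localize ν T) = localize μ T :=
  localize_eq_of_le rfl (le_localize T) (hcoarse.localize_le T)

/-- An adjoined element with negative `ν`-value has `μ`-value zero. Its inverse can be adjoined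
instead: this has nonnegative `ν`-value, and localizing at the center of `μ` gives the same ring. -/
theorem HasUniformization.exists_isGood_localize (hν : IsAmbient ν) (hcoarse : IsCoarsening μ ν)
    {B : Subring L} (h : HasUniformization μ (localize μ B)) :
    ∃ X : Set L, X.Finite ∧ (∀ x ∈ X, 0 ≤ ν x) ∧ IsGood (localize μ (blowup ν B X)) := by
  classical
  obtain ⟨X, hX, hX0, hgood⟩ := h
  rw [blowup, localize_adjoin_localize] at hgood
  have hex : ∀ x ∈ X, ∃ y, 0 ≤ ν y ∧ (y = x ∨ x * y = 1 ∧ μ x = 0 ∧ μ y = 0) := fun x hx => by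
    rcases le_or_gt 0 (ν x) with h0 | h0
    · exact ⟨x, h0, Or.inl rfl⟩
    · obtain ⟨y, hy⟩ := (hν.isUnit x h0.ne_top).exists_right_inv
      have hμx : μ x = 0 := by
        refine le_antisymm ?_ (hX0 x hx)
        rw [← μ.map_one]
        refine hcoarse.mono _ _ ?_
        rw [ν.map_one]
        exact h0.le
      refine ⟨y, ?_, Or.inr ⟨hy, hμx, eq_zero_of_mul_eq_one hy hμx⟩⟩
      have h1 := congrArg ν hy
      rw [ν.map_mul, ν.map_one] at h1
      by_contra! hlt
      exact ((add_le_of_nonpos_right hlt.le).trans_lt h0).ne h1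
  choose! f hf0 hf using hex
  refine ⟨f '' X, hX.image f, by rintro _ ⟨x, hx, rfl⟩; exact hf0 x hx, ?_⟩
  have heq : localize μ (blowup ν B (f '' X)) = localize μ (adjoin B X) := by
    rw [blowup, localize_localize_of_coarsening hcoarse]
    refine le_antisymm ((localize_le_iff (localize_localize _)).2 (adjoin_le_iff.2
      ⟨(le_adjoin _ _).trans (le_localize _), ?_⟩)) ((localize_le_iff (localize_localize _)).2
        (adjoin_le_iff.2 ⟨(le_adjoin _ _).trans (le_localize _), fun x hx => ?_⟩))
    · rintro _ ⟨x, hx, rfl⟩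
      rcases hf x hx with h | ⟨h, h0, -⟩
      · rw [h]
        exact le_localize _ (subset_adjoin _ _ hx)
      · refine ⟨x, subset_adjoin _ _ hx, h0, ?_⟩
        rw [mul_comm, h]
        exact Subring.one_mem _
    · have hfx := subset_adjoin B (f '' X) ⟨x, hx, rfl⟩
      rcases hf x hx with h | ⟨h, -, h0⟩
      · rw [h] at hfx
        exact le_localize _ hfx
      · refine ⟨f x, hfx, h0, ?_⟩
        rw [h]
        exact Subring.one_mem _
  rwa [heq]

theorem exists_surjective_resImage {B C : Subring L} (hle : B ≤ C) (J : Ideal C) :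
    ∃ f : B →+* resImage J B, Function.Surjective f ∧
      ∀ b, Subring.inclusion hle b ∈ J → f b = 0 := by
  refine ⟨((Ideal.Quotient.mk J).comp (Subring.inclusion hle)).codRestrict _
    fun b => ⟨⟨b, hle b.2⟩, b.2, rfl⟩, ?_, fun b hb => Subtype.ext ?_⟩
  · rintro ⟨_, ⟨c, hc, rfl⟩⟩
    exact ⟨⟨c, hc⟩, rfl⟩
  · exact Ideal.Quotient.eq_zero_iff_mem.2 hb

theorem exists_pow_mem_of_mem_sup_nilradical {A : Type*} [CommRing A] {J : Ideal A} {c : A}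
    (hc : c ∈ J ⊔ nilradical A) : ∃ n : ℕ, c ^ n ∈ J := by
  have hle : J ⊔ nilradical A ≤ J.radical :=
    sup_le Ideal.le_radical (Ideal.radical_mono bot_le)
  exact hle hc

/-- The ambient ring and the valuation are quantified inside the induction, since it is applied both
to `μ` on `L` and to the residual valuation on a quotient of `C`. -/
theorem hasUniformization {M : ObjectProperty CommRingCat.{u}} (hM : IsAdmissible M)
    (rank_one : ∀ (R : Type u) [CommRing R] [IsLocalRing R], M (CommRingCat.of R) →
      ∀ (Γ : Type v) [AddCommGroup Γ] [LinearOrder Γ] [IsOrderedAddMonoid Γ]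
        (ν : AddValuation R (WithTop Γ)) (hν : IsCenteredValuation ν),
        rank ν = 1 → AdmitsLocalUniformization hν) (d : ℕ) :
    ∀ {L : Type u} [CommRing L] {Γ : Type v} [AddCommGroup Γ] [LinearOrder Γ]
      [IsOrderedAddMonoid Γ] {ν : AddValuation L (WithTop Γ)} {B : Subring L},
      IsAmbient ν → IsModel ν B → M (.of B) → ringKrullDim B < d → HasUniformization ν B := by
  induction d with
  | zero =>
    intro L _ Γ _ _ _ ν B hν hB _ hd
    have := hB.isLocalRing hν
    exact absurd hd (not_lt.2 ringKrullDim_nonneg_of_nontrivial)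
  | succ d ih =>
    intro L _ Γ _ _ _ ν B hν hB hMB hd
    by_cases htriv : ∀ b ∈ B, ν b = 0 ∨ ν b = ⊤
    · exact .of_forall_eq_zero_or_eq_top hν hB htriv
    push Not at htriv
    have := hB.isLocalRing hν
    by_cases hrank : rank (ν.comap B.subtype) = 1
    · exact .of_admits hν hB (rank_one B hMB Γ _ _ hrank)
    obtain ⟨Γ', _, _, _, μ, hcoarse, ⟨x₁, hx₁, hx₁0⟩, x₂, hx₂B, hx₂, hx₂t⟩ :=
      exists_isCoarsening_of_rank_ne_one hν hB htriv hrank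
    have hμ := hcoarse.isAmbient hν
    have hlt : ∀ {a b : WithBot ℕ∞}, a + 1 ≤ b → b < (d + 1 : ℕ) → a < d := fun {a b} h h' => by
      by_contra! hcon
      refine (h.trans_lt h').not_ge ?_
      push_cast
      gcongr
    have hX₁0 : ∀ x ∈ ({x₁} : Set L), 0 ≤ ν x := by
      rintro _ rfl
      exact hx₁.le
    -- With `x₁` in the model, the center of `μ` is strictly smaller than the maximal ideal, so the
    -- localization at it loses dimension.
    refine .of_blowup (Set.finite_singleton x₁) hX₁0 ?_
    have hd' := (hB.ringKrullDim_blowup_le hν (Set.finite_singleton x₁) hX₁0).trans_lt hd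
    have hM' : M (.of (blowup ν B {x₁})) := hM.localize_adjoin hν hB.toIsOrder
      (Set.finite_singleton x₁) (nonneg_adjoin hB.nonneg hX₁0) hMB
    have hB' := hB.blowup hν (Set.finite_singleton x₁) hX₁0
    have hx₁B : x₁ ∈ blowup ν B {x₁} := subset_blowup B _ rfl
    have hx₂B' : x₂ ∈ blowup ν B {x₁} := le_blowup B _ hx₂B
    clear hd hMB htriv hrank hB hX₁0 this
    generalize blowup ν B {x₁} = B₀ at *
    have hμB₀ : ∀ x ∈ B₀, 0 ≤ μ x := fun x hx => hcoarse.nonneg (hB'.nonneg x hx)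
    obtain ⟨X, hX, hX0, hgood⟩ := (ih hμ (isModel_localize hμ hB'.toIsOrder hμB₀)
      (hM.localize hμ hB'.toIsOrder hμB₀ hM') (hlt (ringKrullDim_localize_add_one_le hν hcoarse hB'
        hx₁B hx₁ hx₁0) hd')).exists_isGood_localize hν hcoarse
    refine .of_blowup hX hX0 ?_
    have hd₁ := (hB'.ringKrullDim_blowup_le hν hX hX0).trans_lt hd'
    have hM₁ : M (.of (blowup ν B₀ X)) := hM.localize_adjoin hν hB'.toIsOrder
      hX (nonneg_adjoin hB'.nonneg hX0) hM'
    have hB₁ := hB'.blowup hν hX hX0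
    have hx₂B₁ : x₂ ∈ blowup ν B₀ X := le_blowup B₀ _ hx₂B'
    generalize blowup ν B₀ X = B₁ at *
    have hμB₁ : ∀ x ∈ B₁, 0 ≤ μ x := fun x hx => hcoarse.nonneg (hB₁.nonneg x hx)
    have hC := isModel_localize hμ hB₁.toIsOrder hμB₁
    have := hC.isLocalRing hμ
    have hle : B₁ ≤ localize μ B₁ := le_localize B₁
    obtain ⟨t, y, hyB, hy, hdim⟩ := exists_parameters hμ rfl hC hgood
    have hJ : Ideal.span (Set.range y) ≤ (residualOn hcoarse _ hC.nonneg).supp := fun c hc => by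
      rw [AddValuation.mem_supp_iff, residualOn_eq_top_iff, ← hC.mem_maximalIdeal_iff hμ, ← hy]
      exact Ideal.mem_sup_left hc
    have hnil : ∀ c : localize μ B₁, 0 < μ (c : L) → ∃ n : ℕ, c ^ n ∈ Ideal.span (Set.range y) :=
      fun c hc => exists_pow_mem_of_mem_sup_nilradical
        (hy ▸ (hC.mem_maximalIdeal_iff hμ).2 hc)
    have hamb := isAmbient_residual (hJ := hJ) hμ hC hnil
    have hres := isModel_resImage (hJ := hJ) hμ hC hB₁ rfl
    obtain ⟨f, hf, hf0⟩ := exists_surjective_resImage hle (Ideal.span (Set.range y))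
    have := hres.isLocalRing hamb
    refine .of_residual hν hcoarse hB₁ rfl hC hgood hyB hy hdim hJ
      (ih hamb hres (hM.of_surjective _ _ f hf hM₁) (hlt ?_ hd₁))
    -- A power of `x₂` lies in `(y)` and so dies in the residual image, while it is a nonzerodivisor
    -- of `B₁`, being a unit of `L`. Hence the residual image has smaller dimension.
    obtain ⟨n, hn⟩ := hnil ⟨x₂, hle hx₂B₁⟩ hx₂
    refine ringKrullDim_succ_le_of_surjective f hf (r := ⟨x₂, hx₂B₁⟩ ^ n) ?_ (hf0 _ hn)
    exact IsOrder.mem_nonZeroDivisors ((hν.isUnit x₂ hx₂t).pow n)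

end Induction

end LocalUniformization


theorem theorem1p1 (M : CategoryTheory.ObjectProperty CommRingCat.{u}) (hM : LocalUniformization.IsAdmissible M)
    (rank_one : ∀ (R : Type u) [CommRing R] [IsLocalRing R], M (CommRingCat.of R) →
      ∀ (Γ : Type v) [AddCommGroup Γ] [LinearOrder Γ] [IsOrderedAddMonoid Γ]
        (ν : AddValuation R (WithTop Γ)) (hν : LocalUniformization.IsCenteredValuation ν),
        LocalUniformization.rank ν = 1 → LocalUniformization.AdmitsLocalUniformization hν) :
    ∀ (R : Type u) [CommRing R] [IsLocalRing R], M (CommRingCat.of R) →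
      ∀ (Γ : Type v) [AddCommGroup Γ] [LinearOrder Γ] [IsOrderedAddMonoid Γ]
        (ν : AddValuation R (WithTop Γ)) (hν : LocalUniformization.IsCenteredValuation ν),
        LocalUniformization.AdmitsLocalUniformization hν := by
  intro R _ _ hR Γ _ _ _ ν hν
  have := hM.isNoetherianRing R hR
  have hamb := LocalUniformization.isAmbient_extendSupp hν
  have hB := LocalUniformization.isModel_extendSupp hν
  have := hB.isLocalRing hamb
  have := hB.noetherian
  obtain ⟨d, hd⟩ := WithBot.ne_bot_iff_exists.1 (ringKrullDim_ne_bot (R := (algebraMap R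
    (Localization.AtPrime (AddValuation.toValuation ν).supp)).range))
  obtain ⟨k, hk⟩ := ENat.ne_top_iff_exists.1 (show d ≠ ⊤ from fun h => by
    rw [h] at hd
    exact ringKrullDim_ne_top hd.symm)
  -- The image of `R` in `L` is a noetherian local ring, so its dimension is a natural number `k`;
  -- the induction is stated with a strict bound, hence `k + 1`.
  refine .of_hasUniformization hν (LocalUniformization.hasUniformization hM rank_one (k + 1) hamb hB
    (hM.of_surjective _ _ _ (RingHom.rangeRestrict_surjective _) hR) ?_)
  rw [← hd, ← hk]
  exact_mod_cast Nat.lt_succ_self k
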